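/- Let $\mathbb K$ be a commutative ring. A chain algebra over $\mathbb K$ is an associative unital graded $\mathbb K$-algebra $A=\bigoplus_{n\ge 0}A_n$ with a $\mathbb K$-linear differential $d:A_n\to A_{n-1}$ (zero on $A_0$), $d^2=0$, satisfying $d(xy)=d(x)y+(-1)^n x\,d(y)$ for $x\in A_n$. Let $\mathbf{DGA}$ be the category of chain algebras; its morphisms are the unital degree-preserving algebra homomorphisms commuting with the differentials. Call a morphism $f:A\to B$ of chain algebras (i) a weak equivalence if it induces an isomorphism $H_n(A)\to H_n(B)$ for all $n\ge 0$; (ii) a fibration if $A_n\to B_n$ is surjective for all $n>0$; (iii) a cofibration if it has the left lifting property with respect to all morphisms which are both fibrations and weak equivalences. **Theorem.** With these choices $\mathbf{DGA}$ is a cofibrantly generated closed model category. Moreover every quasi-free morphism is a cofibration. Here a closed model category is understood in the sense of Quillen: finite limits and colimits exist and the three classes are subcategories (CM1); two-out-of-three for weak equivalences (CM2); closure of the three classes under retracts (CM3); the two lifting axioms (CM4); the two factorization axioms (CM5). It is cofibrantly generated, with classes $W$ (weak equivalences), $\mathrm{Cof}$ and $\mathrm{Fib}$, if the category has all small limits and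 colimits and there are sets $I,J$ of morphisms such that: the domains of $I$ (resp. $J$) are small relative to the relative $I$-cell (resp. $J$-cell) complexes; every relative $J$-cell complex lies in $W\cap I\text{-cof}$; $I\text{-inj}=W\cap J\text{-inj}$; $\mathrm{Cof}=I\text{-cof}$; and $\mathrm{Fib}=J\text{-inj}$. Here $I$-inj is the class of morphisms with the right lifting property with respect to $I$, $I$-cof is the class of morphisms with the left lifting property with respect to $I$-inj, and a relative $I$-cell complex is a transfinite composition of pushouts of elements of $I$. An object $A$ is small relative to a class $D$ if, for some cardinal $\kappa$, $\mathrm{Hom}(A,-)$ commutes with the colimits of all sequences of morphisms in $D$ (continuous at limit stages) indexed by $\kappa$-filtered ordinals. A morphism $f:A\to B$ of chain algebras is quasi-free if there are a graded algebra $X$, isomorphic to the tensor algebra $T(V)$ of a nonnegatively graded $\mathbb K$-module $V$ which is free as a $\mathbb K$-module, and a homomorphism of graded algebras $X\to B$ which together with $f$ exhibits $B$ as the coproduct $A\coprod X$ in the category of graded algebras. -/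

import Mathlib

open CategoryTheory CategoryTheory.Limits

universe w v u

/-! ## Closed model categories and cofibrantly generated ones -/

section ModelStructures

variable {C : Type u} [Category.{v} C]

/-- The classes `W` (weak equivalences), `Cof` (cofibrations) and `Fib` (fibrations) form a closed
model structure on `C`: each class is a subcategory (contains the identities and is closed under
composition) and the axioms CM1 to CM5, as in Mathlib's `HomotopicalAlgebra.ModelCategory`,
hold for these three classes. -/
structure IsClosedModelStructure (W Cof Fib : MorphismProperty C) : Prop where
  multiplicative_W : W.IsMultiplicative
  multiplicative_Cof : Cof.IsMultiplicative
  multiplicative_Fib : Fib.IsMultiplicative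
  exists_modelCategory : ∃ M : HomotopicalAlgebra.ModelCategory C,
    M.categoryWithWeakEquivalences.weakEquivalences = W ∧
    M.categoryWithCofibrations.cofibrations = Cof ∧
    M.categoryWithFibrations.fibrations = Fib

/-- Relative `I`-cell complexes: transfinite compositions, indexed by well-ordered types in
`Type w`, of pushouts of morphisms in `I`. -/
def relativeCellComplexes (I : MorphismProperty C) : MorphismProperty C :=
  MorphismProperty.transfiniteCompositions.{w} I.pushouts

/-- The object `A` is small relative to the class `D`: for some regular cardinal `κ`, the functor
`Hom(A, -)` commutes with the colimit of every (continuous) transfinite sequence of morphisms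
in `D` indexed by a `κ`-filtered limit ordinal. -/
def IsSmallRelativeTo (A : C) (D : MorphismProperty C) : Prop :=
  ∃ (κ : Cardinal.{w}) (_ : Fact κ.IsRegular),
    ∀ (J : Type w) [LinearOrder J] [SuccOrder J] [OrderBot J] [WellFoundedLT J] [NoMaxOrder J]
      [IsCardinalFiltered J κ] (F : J ⥤ C) [F.IsWellOrderContinuous],
      (∀ j : J, D (F.map (homOfLE (Order.le_succ j)))) →
        PreservesColimit F (coyoneda.obj (Opposite.op A))

/-- The classes `W`, `Cof`, `Fib` form a cofibrantly generated closed model structure on `C`: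
`C` has all small limits and colimits, the three classes form a closed model structure, and there
are sets `I` and `J` of morphisms which permit the small object argument, such that the relative
`J`-cell complexes are weak equivalences and `I`-cofibrations, the `I`-injectives are the
`J`-injectives that are weak equivalences, `Cof` is the class of `I`-cofibrations and `Fib` is the
class of `J`-injectives. Here the `I`-injectives are `I.rlp` and the `I`-cofibrations are
`I.rlp.llp`. -/
structure IsCofibrantlyGeneratedModelStructure (W Cof Fib : MorphismProperty C) : Prop where
  hasLimits : HasLimitsOfSize.{w, w} C
  hasColimits : HasColimitsOfSize.{w, w} C
  isClosedModelStructure : IsClosedModelStructure W Cof Fib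
  exists_generating : ∃ I J : MorphismProperty C,
    MorphismProperty.IsSmall.{w} I ∧ MorphismProperty.IsSmall.{w} J ∧
    (∀ ⦃A B : C⦄ (i : A ⟶ B), I i → IsSmallRelativeTo.{w} A (relativeCellComplexes.{w} I)) ∧
    (∀ ⦃A B : C⦄ (j : A ⟶ B), J j → IsSmallRelativeTo.{w} A (relativeCellComplexes.{w} J)) ∧
    relativeCellComplexes.{w} J ≤ W ⊓ I.rlp.llp ∧
    I.rlp = W ⊓ J.rlp ∧
    Cof = I.rlp.llp ∧
    Fib = J.rlp

end ModelStructures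

/-! ## Graded algebras -/

/-- A nonnegatively graded (associative, unital) algebra over `K`. -/
structure GradedAlg (K : Type u) [CommRing K] where
  carrier : Type u
  [ring : Ring carrier]
  [algebra : Algebra K carrier]
  /-- the submodule of homogeneous elements of degree `n` -/
  deg : ℕ → Submodule K carrier
  [graded : GradedAlgebra deg]

namespace GradedAlg

variable {K : Type u} [CommRing K]

instance : CoeSort (GradedAlg K) (Type u) := ⟨carrier⟩

attribute [instance] ring algebra graded

/-- Homomorphisms of unital graded algebras. -/
@[ext]
structure Hom (A B : GradedAlg K) where
  toAlgHom : A →ₐ[K] B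
  map_deg : ∀ (n : ℕ) (a : A), a ∈ A.deg n → toAlgHom a ∈ B.deg n

/-- The identity homomorphism. -/
def Hom.id (A : GradedAlg K) : Hom A A := ⟨AlgHom.id K A, fun _ _ h => h⟩

/-- The composition of homomorphisms (first `f`, then `g`). -/
def Hom.comp {A B C : GradedAlg K} (f : Hom A B) (g : Hom B C) : Hom A C :=
  ⟨g.toAlgHom.comp f.toAlgHom, fun n _ h => g.map_deg n _ (f.map_deg n _ h)⟩

/-- The category of graded algebras over `K`. -/
instance : Category (GradedAlg K) where
  Hom := Hom
  id := Hom.id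
  comp := Hom.comp

/-- A graded algebra `X` is free if it is isomorphic to the tensor algebra of a nonnegatively
graded `K`-module `V` which is free as a `K`-module: there are linear maps `ι n : V n → X` with
values in degree `n` such that the induced algebra homomorphism from the tensor algebra of
`⨁ n, V n` to `X` is bijective. -/
def IsFree (X : GradedAlg K) : Prop :=
  ∃ (V : ℕ → Type u) (_ : ∀ n, AddCommGroup (V n)) (_ : ∀ n, Module K (V n))
    (ι : ∀ n, V n →ₗ[K] X),
    Module.Free K (DirectSum ℕ V) ∧
    (∀ (n : ℕ) (x : V n), ι n x ∈ X.deg n) ∧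
    Function.Bijective (TensorAlgebra.lift K (DirectSum.toModule K ℕ X ι))

end GradedAlg

/-! ## Chain algebras -/

/-- A chain algebra over `K`: a nonnegatively graded algebra with a differential of degree `-1`
satisfying the Leibniz identity. -/
structure ChainAlgebra (K : Type u) [CommRing K] extends GradedAlg K where
  /-- the differential -/
  d : carrier →ₗ[K] carrier
  d_mem : ∀ (n : ℕ) (a : carrier), a ∈ deg (n + 1) → d a ∈ deg n
  d_zero : ∀ a : carrier, a ∈ deg 0 → d a = 0
  d_d : ∀ a : carrier, d (d a) = 0
  leibniz : ∀ (n : ℕ) (x y : carrier), x ∈ deg n → d (x * y) = d x * y + (-1) ^ n * (x * d y)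

namespace ChainAlgebra

variable {K : Type u} [CommRing K]

instance : CoeSort (ChainAlgebra K) (Type u) := ⟨fun A => A.carrier⟩

/-- Homomorphisms of chain algebras: homomorphisms of graded algebras commuting with the
differentials. -/
@[ext]
structure Hom (A B : ChainAlgebra K) extends GradedAlg.Hom A.toGradedAlg B.toGradedAlg where
  map_d : ∀ a : A, toAlgHom (A.d a) = B.d (toAlgHom a)

/-- The category of chain algebras over `K`. -/
instance : Category (ChainAlgebra K) where
  Hom := Hom
  id A := ⟨GradedAlg.Hom.id A.toGradedAlg, fun _ => rfl⟩
  comp f g := ⟨f.toHom.comp g.toHom, fun a =>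
    (congrArg g.toAlgHom (f.map_d a)).trans (g.map_d (f.toAlgHom a))⟩

variable (K) in
/-- The functor which forgets the differential. -/
def forgetDifferential : ChainAlgebra K ⥤ GradedAlg K where
  obj A := A.toGradedAlg
  map f := f.toHom

/-- The `n`-cycles. -/
def cycles (A : ChainAlgebra K) (n : ℕ) : Submodule K A := A.deg n ⊓ LinearMap.ker A.d

/-- The `n`-boundaries. -/
def boundaries (A : ChainAlgebra K) (n : ℕ) : Submodule K A := (A.deg (n + 1)).map A.d

/-- The `n`-th homology module: cycles modulo boundaries. -/
abbrev homology (A : ChainAlgebra K) (n : ℕ) : Type u :=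
  A.cycles n ⧸ (A.boundaries n).submoduleOf (A.cycles n)

theorem boundaries_le_cycles (A : ChainAlgebra K) (n : ℕ) : A.boundaries n ≤ A.cycles n := by
  rintro _ ⟨a, ha, rfl⟩
  exact ⟨A.d_mem n a ha, A.d_d a⟩

/-- The map induced on `n`-cycles. -/
def cyclesMap {A B : ChainAlgebra K} (f : A ⟶ B) (n : ℕ) : A.cycles n →ₗ[K] B.cycles n :=
  f.toAlgHom.toLinearMap.restrict fun a ha =>
    ⟨f.map_deg n a ha.1, by
      have h : A.d a = 0 := ha.2
      change B.d (f.toAlgHom a) = 0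
      rw [← f.map_d, h, map_zero]⟩

/-- The map induced on the `n`-th homology. -/
def homologyMap {A B : ChainAlgebra K} (f : A ⟶ B) (n : ℕ) : A.homology n →ₗ[K] B.homology n :=
  Submodule.mapQ _ _ (cyclesMap f n) <| by
    rintro ⟨_, _⟩ ⟨a, ha, rfl⟩
    exact ⟨f.toAlgHom a, f.map_deg (n + 1) a ha, (f.map_d a).symm⟩

variable (K)

/-- Weak equivalences: morphisms inducing isomorphisms in homology. -/
def weakEquivalences : MorphismProperty (ChainAlgebra K) :=
  fun _ _ f => ∀ n : ℕ, Function.Bijective (homologyMap f n)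

/-- Fibrations: morphisms which are surjective in positive degrees. -/
def fibrations : MorphismProperty (ChainAlgebra K) :=
  fun A B f => ∀ n : ℕ, 0 < n → ∀ b ∈ B.deg n, ∃ a ∈ A.deg n, f.toAlgHom a = b

/-- Cofibrations: morphisms with the left lifting property with respect to all morphisms which are
both fibrations and weak equivalences. -/
def cofibrations : MorphismProperty (ChainAlgebra K) :=
  (fibrations K ⊓ weakEquivalences K).llp

/-- Quasi-free morphisms `f : A ⟶ B`: as a graded algebra, `B` is (through `f`) a coproduct of `A`
and a free graded algebra. -/
def quasiFree : MorphismProperty (ChainAlgebra K) :=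
  fun A B f => ∃ (X : GradedAlg K) (j : X ⟶ B.toGradedAlg), X.IsFree ∧
    Nonempty (IsColimit (BinaryCofan.mk
      (show A.toGradedAlg ⟶ B.toGradedAlg from (forgetDifferential K).map f) j))

end ChainAlgebra

/-! Limits are built by hand, as algebras of compatible families of bounded degree. Colimits and
free chain algebras on one generator then follow from the adjoint functor theorem: any set of
elements lies in a chain subalgebra which, up to isomorphism, belongs to a set depending only on the
size of the given one (`exists_generated`).

Let S(n) be free on a cycle of degree n and D(n+1) free on an arbitrary element of degree n+1. The
generating cofibrations are S(n) → D(n+1), sending the generator to the boundary of the generator,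
together with the map from the initial algebra to S(0); the generating trivial cofibrations are the
maps from the initial algebra to D(n+1). A map out of a free algebra is an element, so lifting
problems become equations. This identifies the maps injective for the two sets with the trivial
fibrations (`generatingCofibrations_rlp`) and the fibrations (`generatingTrivialCofibrations_rlp`).
The domains are finitely presentable, so the small object argument yields both factorizations.

The crux is that f : A → B with the left lifting property against fibrations is a weak equivalence
(`weakEquivalences_of_llp_fibrations`). Such an f factors through a mapping path algebra P(f), whose
evaluation P(f) → B is a fibration. A lift B → P(f) of the identity provides a retraction r of f and
a chain homotopy between the identity of B and f ∘ r. The retract argument then identifies the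
trivial cofibrations with the maps lifting against fibrations.

For a quasi-free map, a lift against a trivial fibration is built by induction on the degree of the
generators. Solving for the generators of degree n is the lifting problem of a generating
cofibration, and projectivity of the generating modules makes the choice of solutions linear
(`exists_lift_generators`). -/

/-! ## Homogeneous components -/

namespace GradedAlg

variable {K : Type u} [CommRing K]

/-- The homogeneous component of degree `n`. -/
def proj (A : GradedAlg K) (n : ℕ) : A →ₗ[K] A := GradedAlgebra.proj A.deg n

section

variable (A : GradedAlg K)

theorem proj_mem (n : ℕ) (a : A) : A.proj n a ∈ A.deg n :=
  (DirectSum.decompose A.deg a n).2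

variable {A}

theorem proj_of_mem {n : ℕ} {a : A} (h : a ∈ A.deg n) : A.proj n a = a :=
  DirectSum.decompose_of_mem_same A.deg h

theorem proj_of_mem_ne {m n : ℕ} {a : A} (h : a ∈ A.deg m) (hmn : m ≠ n) : A.proj n a = 0 :=
  DirectSum.decompose_of_mem_ne A.deg h hmn

theorem mem_deg_iff {n : ℕ} {a : A} : a ∈ A.deg n ↔ A.proj n a = a :=
  ⟨proj_of_mem, fun h => h ▸ A.proj_mem n a⟩

theorem proj_proj_self (n : ℕ) (a : A) : A.proj n (A.proj n a) = A.proj n a :=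
  proj_of_mem (A.proj_mem n a)

theorem proj_proj_ne {m n : ℕ} (h : m ≠ n) (a : A) : A.proj n (A.proj m a) = 0 :=
  proj_of_mem_ne (A.proj_mem m a) h

theorem one_mem : (1 : A) ∈ A.deg 0 := SetLike.GradedOne.one_mem

theorem mul_mem {m n : ℕ} {a b : A} (ha : a ∈ A.deg m) (hb : b ∈ A.deg n) :
    a * b ∈ A.deg (m + n) := SetLike.GradedMul.mul_mem ha hb

theorem proj_zero_one : A.proj 0 1 = 1 := proj_of_mem one_mem

theorem exists_proj_eq_zero (a : A) : ∃ N, ∀ n, N ≤ n → A.proj n a = 0 := by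
  classical
  refine ⟨(DFinsupp.support (DirectSum.decompose A.deg a)).sup id + 1, fun n hn => ?_⟩
  by_contra h
  have : n ∈ DFinsupp.support (DirectSum.decompose A.deg a) := by
    rw [DFinsupp.mem_support_iff]
    exact fun h' => h (congrArg Subtype.val h')
  have := Finset.le_sup (f := id) this
  simp only [id] at this
  omega

theorem ext_proj {a b : A} (h : ∀ n, A.proj n a = A.proj n b) : a = b := by
  apply (DirectSum.decompose A.deg).injective
  ext n
  exact h n

theorem sum_proj {a : A} {N : ℕ} (h : ∀ n, N ≤ n → A.proj n a = 0) :
    ∑ i ∈ Finset.range N, A.proj i a = a := by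
  refine ext_proj fun n => ?_
  rw [map_sum]
  by_cases hn : n < N
  · rw [Finset.sum_eq_single n (fun m _ hm => proj_proj_ne hm a)
      (fun h => absurd (Finset.mem_range.2 hn) h), proj_proj_self]
  · rw [h n (not_lt.1 hn)]
    exact Finset.sum_eq_zero fun m hm =>
      proj_proj_ne (by have := Finset.mem_range.1 hm; omega) a

@[elab_as_elim]
theorem homogeneous_induction {p : A → Prop} (a : A) (zero : p 0)
    (hom : ∀ (n : ℕ) (x : A), x ∈ A.deg n → p x)
    (add : ∀ x y, p x → p y → p (x + y)) : p a :=
  DirectSum.Decomposition.inductionOn A.deg zero (fun {i} m => hom i m m.2) add a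

theorem proj_mul (n : ℕ) (x y : A) :
    A.proj n (x * y) = ∑ ij ∈ Finset.HasAntidiagonal.antidiagonal n, A.proj ij.1 x * A.proj ij.2 y := by
  refine homogeneous_induction x ?_ (fun a x hx => ?_) (fun x x' hx hx' => ?_)
  · simp
  · refine homogeneous_induction y ?_ (fun b y hy => ?_) (fun y y' hy hy' => ?_)
    · simp
    · by_cases h : a + b = n
      · rw [Finset.sum_eq_single (a, b), proj_of_mem hx, proj_of_mem hy,
          proj_of_mem (h ▸ mul_mem hx hy)]
        · rintro ⟨i, j⟩ hij hne
          rw [Finset.HasAntidiagonal.mem_antidiagonal] at hij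
          by_cases hi : a = i
          · rw [proj_of_mem_ne hy (n := j), mul_zero]
            rintro rfl
            exact hne (by rw [hi])
          · rw [proj_of_mem_ne hx hi, zero_mul]
        · exact fun h' => absurd (Finset.HasAntidiagonal.mem_antidiagonal.2 h) h'
      · rw [proj_of_mem_ne (mul_mem hx hy) h, Finset.sum_eq_zero]
        rintro ⟨i, j⟩ hij
        rw [Finset.HasAntidiagonal.mem_antidiagonal] at hij
        by_cases hi : a = i
        · rw [proj_of_mem_ne hy (n := j), mul_zero]
          dsimp at *
          omega
        · rw [proj_of_mem_ne hx hi, zero_mul]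
    · simp only [mul_add, map_add, hy, hy', Finset.sum_add_distrib]
  · simp only [add_mul, map_add, hx, hx', Finset.sum_add_distrib]

theorem proj_zero_mul (x y : A) : A.proj 0 (x * y) = A.proj 0 x * A.proj 0 y := by
  simp [proj_mul]

theorem map_proj {A B : GradedAlg K} (f : A ⟶ B) (n : ℕ) (a : A) :
    f.toAlgHom (A.proj n a) = B.proj n (f.toAlgHom a) := by
  refine homogeneous_induction a ?_ (fun m x hx => ?_) (fun x x' hx hx' => ?_)
  · simp
  · by_cases h : m = n
    · subst h
      rw [proj_of_mem hx, proj_of_mem (f.map_deg _ _ hx)]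
    · rw [proj_of_mem_ne hx h, proj_of_mem_ne (f.map_deg _ _ hx) h, map_zero]
  · simp only [map_add, hx, hx']

/-- An algebra homomorphism commuting with the homogeneous components is a homomorphism of graded
algebras. -/
def homOfProj {A B : GradedAlg K} (f : A →ₐ[K] B) (h : ∀ n a, f (A.proj n a) = B.proj n (f a)) :
    A ⟶ B :=
  ⟨f, fun n a ha => mem_deg_iff.2 (by rw [← h, proj_of_mem ha])⟩

end

end GradedAlg

namespace ChainAlgebra

variable {K : Type u} [CommRing K]

open GradedAlg

theorem d_proj_zero (A : ChainAlgebra K) (a : A) : A.d (A.proj 0 a) = 0 :=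
  A.d_zero _ (A.proj_mem 0 a)

theorem proj_d (A : ChainAlgebra K) (n : ℕ) (a : A) :
    A.proj n (A.d a) = A.d (A.proj (n + 1) a) := by
  refine homogeneous_induction a ?_ (fun m x hx => ?_) (fun x x' hx hx' => ?_)
  · simp
  · obtain _ | m := m
    · rw [A.d_zero x hx, proj_of_mem_ne hx (by omega), map_zero, map_zero]
    · by_cases h : m = n
      · subst h
        rw [proj_of_mem hx, proj_of_mem (A.d_mem _ _ hx)]
      · rw [proj_of_mem_ne hx (by omega), proj_of_mem_ne (A.d_mem _ _ hx) h, map_zero]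
  · simp only [map_add, hx, hx']

theorem d_one (A : ChainAlgebra K) : A.d 1 = 0 := A.d_zero 1 one_mem

theorem map_proj {A B : ChainAlgebra K} (f : A ⟶ B) (n : ℕ) (a : A) :
    f.toAlgHom (A.proj n a) = B.proj n (f.toAlgHom a) :=
  GradedAlg.map_proj (A := A.toGradedAlg) (B := B.toGradedAlg) f.toHom n a

theorem hom_ext {A B : ChainAlgebra K} {f g : A ⟶ B} (h : ∀ x, f.toAlgHom x = g.toAlgHom x) :
    f = g :=
  Hom.ext (AlgHom.ext h)

@[simp] theorem comp_apply {A B C : ChainAlgebra K} (f : A ⟶ B) (g : B ⟶ C) (x : A) :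
    (f ≫ g).toAlgHom x = g.toAlgHom (f.toAlgHom x) := rfl

@[simp] theorem id_apply {A : ChainAlgebra K} (x : A) : (Hom.toHom (𝟙 A)).toAlgHom x = x := rfl

theorem hom_congr {A B : ChainAlgebra K} {f g : A ⟶ B} (h : f = g) (x : A) :
    f.toAlgHom x = g.toAlgHom x := by rw [h]

end ChainAlgebra

/-! ### Chain algebras presented by projection operators, so that most axioms are equations. -/

/-- Homogeneous components and a differential turning the algebra `R` into a chain algebra. -/
structure ChainStructure (K : Type u) [CommRing K] (R : Type u) [Ring R] [Algebra K R] where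
  /-- the homogeneous components -/
  p : ℕ → R →ₗ[K] R
  /-- the differential -/
  d : R →ₗ[K] R
  p_one : p 0 1 = 1
  p_mul : ∀ m n x y, p (m + n) (p m x * p n y) = p m x * p n y
  p_p_self : ∀ n x, p n (p n x) = p n x
  p_p_ne : ∀ m n x, m ≠ n → p n (p m x) = 0
  exists_sum_eq : ∀ x, ∃ N, ∑ i ∈ Finset.range N, p i x = x
  p_d_p : ∀ n x, p n (d (p (n + 1) x)) = d (p (n + 1) x)
  d_p_zero : ∀ x, d (p 0 x) = 0
  d_d : ∀ x, d (d x) = 0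
  leibniz : ∀ n x y, d (p n x * y) = d (p n x) * y + (-1) ^ n * (p n x * d y)

namespace ChainStructure

variable {K : Type u} [CommRing K] {R : Type u} [Ring R] [Algebra K R] (S : ChainStructure K R)

theorem mem_range_iff (n : ℕ) (x : R) : x ∈ LinearMap.range (S.p n) ↔ S.p n x = x := by
  constructor
  · rintro ⟨y, rfl⟩
    exact S.p_p_self n y
  · exact fun h => ⟨x, h⟩

instance gradedMonoid : SetLike.GradedMonoid (fun n => LinearMap.range (S.p n)) where
  one_mem := (S.mem_range_iff _ _).2 S.p_one
  mul_mem := by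
    rintro m n _ _ ⟨x, rfl⟩ ⟨y, rfl⟩
    exact (S.mem_range_iff _ _).2 (S.p_mul m n x y)

theorem p_coeLinearMap (x : DirectSum ℕ fun n => LinearMap.range (S.p n)) (n : ℕ) :
    S.p n (DirectSum.coeLinearMap (fun n => LinearMap.range (S.p n)) x) = x n := by
  induction x using DirectSum.induction_on with
  | zero => simp
  | of i x =>
    erw [DirectSum.coeLinearMap_of]
    obtain ⟨_, x, rfl⟩ := x
    by_cases h : i = n
    · subst h
      simp [S.p_p_self]
    · rw [S.p_p_ne _ _ _ h, DirectSum.of_eq_of_ne _ _ _ (Ne.symm h)]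
      rfl
  | add x y hx hy => simp [hx, hy]

theorem isInternal : DirectSum.IsInternal fun n => LinearMap.range (S.p n) := by
  constructor
  · intro x y h
    ext n
    rw [← p_coeLinearMap, ← p_coeLinearMap]
    exact congrArg _ h
  · intro x
    obtain ⟨N, hN⟩ := S.exists_sum_eq x
    refine ⟨∑ i ∈ Finset.range N, DirectSum.of (fun n => LinearMap.range (S.p n)) i
      ⟨S.p i x, x, rfl⟩, ?_⟩
    rw [map_sum]
    conv_rhs => rw [← hN]
    exact Finset.sum_congr rfl fun i _ => DirectSum.coeAddMonoidHom_of _ _ _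

/-- The chain algebra defined by a chain structure. -/
noncomputable def toChainAlgebra : ChainAlgebra K where
  carrier := R
  deg n := LinearMap.range (S.p n)
  graded := { S.gradedMonoid, S.isInternal.chooseDecomposition with }
  d := S.d
  d_mem := by
    rintro n _ ⟨x, rfl⟩
    exact (S.mem_range_iff _ _).2 (S.p_d_p n x)
  d_zero := by
    rintro _ ⟨x, rfl⟩
    exact S.d_p_zero x
  d_d := S.d_d
  leibniz := by
    rintro n _ y ⟨x, rfl⟩
    exact S.leibniz n x y

/-- The decomposition of `toChainAlgebra` is chosen from `isInternal`, so this is not definitional;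
it holds because the components of an element are determined by the submodules `deg`. -/
theorem proj_toChainAlgebra (n : ℕ) (x : R) : S.toChainAlgebra.proj n x = S.p n x := by
  obtain ⟨N, hN⟩ := S.exists_sum_eq x
  have h (i : ℕ) : S.p i x ∈ S.toChainAlgebra.deg i := ⟨x, rfl⟩
  conv_lhs => rw [← hN]
  conv_rhs => rw [← hN]
  rw [map_sum]
  erw [map_sum]
  refine Finset.sum_congr rfl fun i _ => ?_
  by_cases hi : i = n
  · subst hi
    rw [S.p_p_self]
    exact GradedAlg.proj_of_mem (h i)
  · rw [S.p_p_ne _ _ _ hi]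
    exact GradedAlg.proj_of_mem_ne (h i) hi

/-- A chain algebra homomorphism from an algebra homomorphism commuting with all the structure. -/
noncomputable def homMk {A B : ChainAlgebra K} (f : A →ₐ[K] B)
    (hp : ∀ n a, f (A.proj n a) = B.proj n (f a)) (hd : ∀ a, f (A.d a) = B.d (f a)) : A ⟶ B :=
  { GradedAlg.homOfProj (A := A.toGradedAlg) (B := B.toGradedAlg) f hp with map_d := hd }

/-- A homomorphism from the chain algebra defined by a chain structure. -/
noncomputable def homFrom {B : ChainAlgebra K} (f : R →ₐ[K] B)
    (hp : ∀ n a, f (S.p n a) = B.proj n (f a)) (hd : ∀ a, f (S.d a) = B.d (f a)) :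
    S.toChainAlgebra ⟶ B :=
  homMk (A := S.toChainAlgebra) f (fun n a => (congrArg f (S.proj_toChainAlgebra n a)).trans (hp n a)) hd

/-- A homomorphism to the chain algebra defined by a chain structure. -/
noncomputable def homTo {A : ChainAlgebra K} (f : A →ₐ[K] R)
    (hp : ∀ n a, f (A.proj n a) = S.p n (f a)) (hd : ∀ a, f (A.d a) = S.d (f a)) :
    A ⟶ S.toChainAlgebra :=
  homMk (B := S.toChainAlgebra) f (fun n a => (hp n a).trans (S.proj_toChainAlgebra n _).symm) hd

/-- Operators on an algebra form a chain structure if they correspond to those of a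
jointly injective family of homomorphisms to chain algebras. -/
def ofInjective {ι : Type*} (A : ι → ChainAlgebra K) (f : ∀ i, R →ₐ[K] A i)
    (hf : ∀ x y, (∀ i, f i x = f i y) → x = y) (p : ℕ → R →ₗ[K] R) (d : R →ₗ[K] R)
    (hp : ∀ i n x, f i (p n x) = (A i).proj n (f i x)) (hd : ∀ i x, f i (d x) = (A i).d (f i x))
    (hN : ∀ x, ∃ N, ∀ n i, N ≤ n → (A i).proj n (f i x) = 0) : ChainStructure K R where
  p := p
  d := d
  p_one := hf _ _ fun i => by simp only [hp, map_one, GradedAlg.proj_zero_one]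
  p_mul m n x y := hf _ _ fun i => by
    simp only [hp, map_mul]
    exact GradedAlg.proj_of_mem (GradedAlg.mul_mem (GradedAlg.proj_mem _ _ _)
      (GradedAlg.proj_mem _ _ _))
  p_p_self n x := hf _ _ fun i => by simp only [hp, GradedAlg.proj_proj_self]
  p_p_ne m n x h := hf _ _ fun i => by simp only [hp, GradedAlg.proj_proj_ne h, map_zero]
  -- The only axiom that is not an equation: it needs one degree bound valid for all `i`, which `hN`
  -- supplies.
  exists_sum_eq x := by
    obtain ⟨N, hN⟩ := hN x
    refine ⟨N, hf _ _ fun i => ?_⟩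
    simp only [map_sum, hp]
    exact GradedAlg.sum_proj fun n hn => hN n i hn
  p_d_p n x := hf _ _ fun i => by
    simp only [hp, hd, ChainAlgebra.proj_d, GradedAlg.proj_proj_self]
  d_p_zero x := hf _ _ fun i => by simp only [hp, hd, ChainAlgebra.d_proj_zero, map_zero]
  d_d x := hf _ _ fun i => by simp only [hd, ChainAlgebra.d_d, map_zero]
  leibniz n x y := hf _ _ fun i => by
    simp only [hp, hd, map_mul, map_add, map_pow, map_neg, map_one]
    exact (A i).leibniz n _ _ (GradedAlg.proj_mem _ _ _)

end ChainStructure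

/-! ## Limits of chain algebras -/

namespace ChainAlgebra

variable {K : Type u} [CommRing K]

open GradedAlg

section Limits

variable {J : Type u} [Category.{u} J] (F : J ⥤ ChainAlgebra K)

/-- The compatible families whose homogeneous components vanish in large degrees. -/
def limitSubalgebra : Subalgebra K (∀ j, F.obj j) where
  -- The bound `N` is common to all `j`: otherwise a family could have infinitely many nonzero
  -- components and fail to be their finite sum.
  carrier := {x | (∀ ⦃i j : J⦄ (f : i ⟶ j), (F.map f).toAlgHom (x i) = x j) ∧
    ∃ N, ∀ n j, N ≤ n → (F.obj j).proj n (x j) = 0}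
  mul_mem' := by
    rintro x y ⟨hx, M, hM⟩ ⟨hy, N, hN⟩
    refine ⟨fun i j f => by simp only [Pi.mul_apply, map_mul, hx, hy], M + N, fun n j hn => ?_⟩
    rw [Pi.mul_apply, proj_mul]
    refine Finset.sum_eq_zero fun ij hij => ?_
    rw [Finset.HasAntidiagonal.mem_antidiagonal] at hij
    by_cases h : M ≤ ij.1
    · rw [hM _ _ h, zero_mul]
    · rw [hN _ _ (by omega), mul_zero]
  add_mem' := by
    rintro x y ⟨hx, M, hM⟩ ⟨hy, N, hN⟩
    refine ⟨fun i j f => by simp only [Pi.add_apply, map_add, hx, hy], M + N, fun n j hn => ?_⟩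
    rw [Pi.add_apply, map_add, hM n j (by omega), hN n j (by omega), add_zero]
  algebraMap_mem' r := by
    refine ⟨fun i j f => by simp, 1, fun n j hn => ?_⟩
    rw [Pi.algebraMap_apply, Algebra.algebraMap_eq_smul_one, map_smul,
      proj_of_mem_ne one_mem (by omega), smul_zero]

theorem limitSubalgebra_mem_of_deg {x : ∀ j, F.obj j}
    (hx : ∀ ⦃i j : J⦄ (f : i ⟶ j), (F.map f).toAlgHom (x i) = x j) (n : ℕ)
    (hn : ∀ j, x j ∈ (F.obj j).deg n) : x ∈ limitSubalgebra F :=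
  ⟨hx, n + 1, fun m j hm => proj_of_mem_ne (hn j) (by omega)⟩

/-- The chain structure on the limit. -/
def limitStructure : ChainStructure K (limitSubalgebra F) :=
  ChainStructure.ofInjective (fun j => F.obj j)
    (fun j => (Pi.evalAlgHom K (fun j => F.obj j) j).comp (limitSubalgebra F).val)
    (fun x y h => Subtype.ext (funext h))
    (fun n =>
      { toFun := fun x => ⟨fun j => (F.obj j).proj n (x.1 j),
          limitSubalgebra_mem_of_deg F (fun i j f => by rw [map_proj, x.2.1]) n
            fun j => proj_mem _ _ _⟩
        map_add' := fun x y => Subtype.ext (funext fun j => map_add _ _ _)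
        map_smul' := fun x y => Subtype.ext (funext fun j => map_smul _ _ _) })
    { toFun := fun x => ⟨fun j => (F.obj j).d (x.1 j),
        fun i j f => by rw [(F.map f).map_d, x.2.1], by
          obtain ⟨N, hN⟩ := x.2.2
          exact ⟨N, fun n j hn => by rw [proj_d, hN _ _ (by omega), map_zero]⟩⟩
      map_add' := fun x y => Subtype.ext (funext fun j => map_add _ _ _)
      map_smul' := fun x y => Subtype.ext (funext fun j => map_smul _ _ _) }
    (fun _ _ _ => rfl) (fun _ _ => rfl) (fun x => x.2.2)

/-- The limit cone. -/
noncomputable def limitCone : Cone F where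
  pt := (limitStructure F).toChainAlgebra
  π :=
    { app := fun j => (limitStructure F).homFrom
        ((Pi.evalAlgHom K (fun j => F.obj j) j).comp (limitSubalgebra F).val)
        (fun _ _ => rfl) (fun _ => rfl)
      naturality := fun _ _ f => hom_ext fun x => (x.2.1 f).symm }

theorem cone_w (s : Cone F) {i j : J} (f : i ⟶ j) (x : s.pt) :
    (F.map f).toAlgHom ((s.π.app i).toAlgHom x) = (s.π.app j).toAlgHom x :=
  hom_congr (s.w f) x

/-- The limit cone is a limit. -/
noncomputable def limitConeIsLimit : IsLimit (limitCone F) where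
  lift s := (limitStructure F).homTo (A := s.pt)
    ((AlgHom.pi fun j => (s.π.app j).toAlgHom :
      s.pt →ₐ[K] ∀ j, F.obj j).codRestrict (limitSubalgebra F) fun x =>
      ⟨fun i j f => cone_w F s f x, by
        obtain ⟨N, hN⟩ := exists_proj_eq_zero x
        refine ⟨N, fun n j hn => ?_⟩
        exact (map_proj (s.π.app j) n x).symm.trans (by erw [hN n hn]; exact map_zero _)⟩)
    (fun n a => Subtype.ext (funext fun j => map_proj _ _ _))
    (fun a => Subtype.ext (funext fun j => (s.π.app j).map_d a))
  fac s j := rfl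
  uniq s m hm := hom_ext fun x => Subtype.ext (funext fun j => hom_congr (hm j) x)

theorem limitCone_ext {x y : (limitCone F).pt}
    (h : ∀ j, ((limitCone F).π.app j).toAlgHom x = ((limitCone F).π.app j).toAlgHom y) : x = y :=
  Subtype.ext (funext h)

end Limits

instance : HasLimitsOfSize.{u, u} (ChainAlgebra K) where
  has_limits_of_shape _ _ := ⟨fun F => ⟨⟨limitCone F, limitConeIsLimit F⟩⟩⟩

/-! ### Homogeneous elements and cycles -/

/-- The submodule of homogeneous elements of degree `n`, which are moreover cycles if `P` holds. -/
def homogeneous (A : ChainAlgebra K) (n : ℕ) (P : Prop) : Submodule K A where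
  carrier := {a | a ∈ A.deg n ∧ (P → A.d a = 0)}
  add_mem' ha hb := ⟨add_mem ha.1 hb.1, fun h => by rw [map_add, ha.2 h, hb.2 h, add_zero]⟩
  zero_mem' := ⟨zero_mem _, fun _ => map_zero _⟩
  smul_mem' r a ha := ⟨Submodule.smul_mem _ r ha.1, fun h => by rw [map_smul, ha.2 h, smul_zero]⟩

theorem map_mem_homogeneous {A B : ChainAlgebra K} (f : A ⟶ B) {n : ℕ} {P : Prop} {a : A}
    (h : a ∈ A.homogeneous n P) : f.toAlgHom a ∈ B.homogeneous n P :=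
  ⟨f.map_deg _ _ h.1, fun hP => by rw [← f.map_d, h.2 hP, map_zero]⟩

theorem mem_homogeneous_of_injective {ι : Type*} {A : ChainAlgebra K} {B : ι → ChainAlgebra K}
    (f : ∀ i, A ⟶ B i) (hf : ∀ x y, (∀ i, (f i).toAlgHom x = (f i).toAlgHom y) → x = y)
    {n : ℕ} {P : Prop} {a : A} (h : ∀ i, (f i).toAlgHom a ∈ (B i).homogeneous n P) :
    a ∈ A.homogeneous n P :=
  ⟨mem_deg_iff.2 (hf _ _ fun i => by rw [map_proj, proj_of_mem (h i).1]),
    fun hP => hf _ _ fun i => by rw [(f i).map_d, (h i).2 hP, map_zero]⟩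

variable (K) in
/-- The functor of homogeneous elements of degree `n` (which are cycles if `P` holds). -/
def homogeneousFunctor (n : ℕ) (P : Prop) : ChainAlgebra K ⥤ Type u where
  obj A := A.homogeneous n P
  map f := TypeCat.ofHom fun a => ⟨f.toAlgHom a.1, map_mem_homogeneous f a.2⟩

/-- Entries of one fixed degree are automatically bounded, so the bound in `limitSubalgebra` is no
restriction here. This continuity is what the adjoint functor theorem needs. -/
instance (n : ℕ) (P : Prop) : PreservesLimitsOfSize.{u, u} (homogeneousFunctor K n P) where
  preservesLimitsOfShape {J _} := ⟨fun {F} =>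
    preservesLimit_of_preserves_limit_cone (limitConeIsLimit F) <| by
      refine ((Types.isLimit_iff _).2 fun s hs => ?_).some
      have hs' (i j : J) (f : i ⟶ j) : (F.map f).toAlgHom (s i).1 = (s j).1 :=
        congrArg Subtype.val (hs f)
      refine ⟨⟨⟨fun j => (s j).1, limitSubalgebra_mem_of_deg F hs' n fun j => (s j).2.1⟩,
        mem_homogeneous_of_injective (fun j => (limitCone F).π.app j)
          (fun x y h => limitCone_ext F h) fun j => (s j).2⟩, fun j => rfl, fun y hy => ?_⟩
      exact Subtype.ext (limitCone_ext F fun j => congrArg Subtype.val (hy j))⟩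

end ChainAlgebra

/-! ## Generated chain algebras and colimits -/

/-- Operators on an algebra embedded in a chain algebra, with stable image. -/
noncomputable def ChainStructure.ofRange {K : Type u} [CommRing K] {R : Type u} [Ring R]
    [Algebra K R] {A : ChainAlgebra K} (f : R →ₐ[K] A) (hf : Function.Injective f)
    (hp : ∀ n x, A.proj n (f x) ∈ f.range) (hd : ∀ x, A.d (f x) ∈ f.range) :
    ChainStructure K R :=
  ofInjective (fun _ : Unit => A) (fun _ => f) (fun _ _ h => hf (h ()))
    (fun n => (AlgEquiv.ofInjective f hf).symm.toLinearMap.comp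
      (((A.proj n).comp f.toLinearMap).codRestrict (Subalgebra.toSubmodule f.range) (hp n)))
    ((AlgEquiv.ofInjective f hf).symm.toLinearMap.comp
      ((A.d.comp f.toLinearMap).codRestrict (Subalgebra.toSubmodule f.range) hd))
    (fun _ n x => congrArg Subtype.val
      ((AlgEquiv.ofInjective f hf).apply_symm_apply ⟨A.proj n (f x), hp n x⟩))
    (fun _ x => congrArg Subtype.val
      ((AlgEquiv.ofInjective f hf).apply_symm_apply ⟨A.d (f x), hd x⟩))
    (fun x => by
      obtain ⟨N, hN⟩ := GradedAlg.exists_proj_eq_zero (f x)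
      exact ⟨N, fun n _ hn => hN n hn⟩)

theorem ChainStructure.ofRange_p {K : Type u} [CommRing K] {R : Type u} [Ring R]
    [Algebra K R] {A : ChainAlgebra K} (f : R →ₐ[K] A) (hf : Function.Injective f)
    (hp : ∀ n x, A.proj n (f x) ∈ f.range) (hd : ∀ x, A.d (f x) ∈ f.range) (n : ℕ) (x : R) :
    f ((ofRange f hf hp hd).p n x) = A.proj n (f x) :=
  congrArg Subtype.val ((AlgEquiv.ofInjective f hf).apply_symm_apply ⟨A.proj n (f x), hp n x⟩)

theorem ChainStructure.ofRange_d {K : Type u} [CommRing K] {R : Type u} [Ring R]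
    [Algebra K R] {A : ChainAlgebra K} (f : R →ₐ[K] A) (hf : Function.Injective f)
    (hp : ∀ n x, A.proj n (f x) ∈ f.range) (hd : ∀ x, A.d (f x) ∈ f.range) (x : R) :
    f ((ofRange f hf hp hd).d x) = A.d (f x) :=
  congrArg Subtype.val ((AlgEquiv.ofInjective f hf).apply_symm_apply ⟨A.d (f x), hd x⟩)

namespace ChainAlgebra

variable {K : Type u} [CommRing K]

open GradedAlg

section Generation

variable {S : Type u} {A : ChainAlgebra K} (f : S → A)

/-- The homomorphism from the free algebra whose range is generated by the homogeneous components
of the elements `f s` and by their differentials. -/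
noncomputable def generatingHom : FreeAlgebra K (S × ℕ × Bool) →ₐ[K] A :=
  FreeAlgebra.lift K fun s =>
    if s.2.2 then A.d (A.proj s.2.1 (f s.1)) else A.proj s.2.1 (f s.1)

theorem proj_mem_range_generatingHom (s : S) (n : ℕ) : A.proj n (f s) ∈ (generatingHom f).range :=
  ⟨FreeAlgebra.ι K (s, n, false), by simp [generatingHom]⟩

theorem d_proj_mem_range_generatingHom (s : S) (n : ℕ) :
    A.d (A.proj n (f s)) ∈ (generatingHom f).range :=
  ⟨FreeAlgebra.ι K (s, n, true), by simp [generatingHom]⟩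

theorem mem_range_generatingHom (s : S) : f s ∈ (generatingHom f).range := by
  obtain ⟨N, hN⟩ := exists_proj_eq_zero (f s)
  rw [← sum_proj hN]
  exact sum_mem fun i _ => proj_mem_range_generatingHom f s i

/-- The Leibniz identity is available only for a homogeneous left factor, so the induction must
carry components and their differentials together. Adjoining differentials once suffices, as `d`
squares to zero. -/
theorem generatingHom_stable (x : FreeAlgebra K (S × ℕ × Bool)) (n : ℕ) :
    A.proj n (generatingHom f x) ∈ (generatingHom f).range ∧
      A.d (A.proj n (generatingHom f x)) ∈ (generatingHom f).range := by
  induction x using FreeAlgebra.induction generalizing n with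
  | grade0 r =>
    rw [AlgHom.commutes, Algebra.algebraMap_eq_smul_one, map_smul, map_smul]
    by_cases h : 0 = n
    · subst h
      rw [proj_zero_one, d_one]
      exact ⟨Subalgebra.smul_mem _ (one_mem _) r, Subalgebra.smul_mem _ (zero_mem _) r⟩
    · rw [proj_of_mem_ne GradedAlg.one_mem h, map_zero]
      exact ⟨Subalgebra.smul_mem _ (zero_mem _) r, Subalgebra.smul_mem _ (zero_mem _) r⟩
  | grade1 s =>
    obtain ⟨s, m, b⟩ := s
    cases b
    · have h : generatingHom f (FreeAlgebra.ι K (s, m, false)) = A.proj m (f s) := by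
        simp [generatingHom]
      rw [h]
      by_cases hm : m = n
      · subst hm
        rw [proj_proj_self]
        exact ⟨proj_mem_range_generatingHom f s m, d_proj_mem_range_generatingHom f s m⟩
      · rw [proj_proj_ne hm, map_zero]
        exact ⟨zero_mem _, zero_mem _⟩
    · have h : generatingHom f (FreeAlgebra.ι K (s, m, true)) = A.d (A.proj m (f s)) := by
        simp [generatingHom]
      rw [h, proj_d, A.d_d]
      refine ⟨?_, zero_mem _⟩
      by_cases hm : m = n + 1
      · subst hm
        rw [proj_proj_self]
        exact d_proj_mem_range_generatingHom f s _
      · rw [proj_proj_ne hm, map_zero]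
        exact zero_mem _
  | mul x y hx hy =>
    rw [map_mul, proj_mul, map_sum]
    refine ⟨sum_mem fun ij _ => mul_mem (hx _).1 (hy _).1, sum_mem fun ij _ => ?_⟩
    rw [A.leibniz _ _ _ (proj_mem _ _ _)]
    exact add_mem (mul_mem (hx _).2 (hy _).1) (mul_mem (pow_mem (neg_mem (one_mem _)) _)
      (mul_mem (hx _).1 (hy _).2))
  | add x y hx hy =>
    simp only [map_add]
    exact ⟨add_mem (hx n).1 (hy n).1, add_mem (hx n).2 (hy n).2⟩

theorem d_generatingHom_mem (x : FreeAlgebra K (S × ℕ × Bool)) :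
    A.d (generatingHom f x) ∈ (generatingHom f).range := by
  obtain ⟨N, hN⟩ := exists_proj_eq_zero (generatingHom f x)
  rw [← sum_proj hN, map_sum]
  exact sum_mem fun i _ => (generatingHom_stable f x i).2

variable (K) in
/-- A small set of models of the chain algebras generated by a set indexed by `S`. -/
def GeneratedIndex (S : Type u) : Type u :=
  Σ r : FreeAlgebra K (S × ℕ × Bool) → FreeAlgebra K (S × ℕ × Bool) → Prop,
    ChainStructure K (RingQuot r)

/-- The chain algebra attached to an index. -/
noncomputable def GeneratedIndex.obj {S : Type u} (i : GeneratedIndex K S) : ChainAlgebra K :=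
  i.2.toChainAlgebra

/-- Dividing the free algebra by the kernel relation of `generatingHom` gives an algebra embedded in
`A` with stable image, which inherits a chain structure. Since `GeneratedIndex K S` depends only on
`S` and lies in `Type u`, this provides the solution sets. -/
theorem exists_generated :
    ∃ (i : GeneratedIndex K S) (g : i.obj ⟶ A), Function.Injective g.toAlgHom ∧
      ∀ s, f s ∈ g.toAlgHom.range := by
  let r : FreeAlgebra K (S × ℕ × Bool) → FreeAlgebra K (S × ℕ × Bool) → Prop :=
    fun x y => generatingHom f x = generatingHom f y
  let φ : RingQuot r →ₐ[K] A := RingQuot.liftAlgHom K ⟨generatingHom f, fun _ _ h => h⟩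
  have hφ (x) : φ (RingQuot.mkAlgHom K r x) = generatingHom f x :=
    RingQuot.liftAlgHom_mkAlgHom_apply _ _ _ _
  have hsurj := RingQuot.mkAlgHom_surjective K r
  have hinj : Function.Injective φ := fun x y h => by
    obtain ⟨x, rfl⟩ := hsurj x
    obtain ⟨y, rfl⟩ := hsurj y
    rw [hφ, hφ] at h
    exact RingQuot.mkAlgHom_rel K h
  have hrange : (generatingHom f).range ≤ φ.range := by
    rintro _ ⟨x, rfl⟩
    exact ⟨RingQuot.mkAlgHom K r x, hφ x⟩
  have hp (n x) : A.proj n (φ x) ∈ φ.range := by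
    obtain ⟨x, rfl⟩ := hsurj x
    rw [hφ]
    exact hrange (generatingHom_stable f x n).1
  have hd (x) : A.d (φ x) ∈ φ.range := by
    obtain ⟨x, rfl⟩ := hsurj x
    rw [hφ]
    exact hrange (d_generatingHom_mem f x)
  exact ⟨⟨r, .ofRange φ hinj hp hd⟩, ChainStructure.homFrom _ φ
    (fun n x => ChainStructure.ofRange_p φ hinj hp hd n x)
    (fun x => ChainStructure.ofRange_d φ hinj hp hd x), hinj,
    fun s => hrange (mem_range_generatingHom f s)⟩

end Generation

/-- Corestriction of a homomorphism along an injective homomorphism containing its image. -/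
theorem exists_factor {A B X : ChainAlgebra K} (h : X ⟶ A) (g : B ⟶ A)
    (hg : Function.Injective g.toAlgHom) (hX : ∀ x, h.toAlgHom x ∈ g.toAlgHom.range) :
    ∃ k : X ⟶ B, k ≫ g = h := by
  let e := AlgEquiv.ofInjective g.toAlgHom hg
  let k : X →ₐ[K] B := (e.symm : g.toAlgHom.range →ₐ[K] B).comp (h.toAlgHom.codRestrict _ hX)
  have hk (x) : g.toAlgHom (k x) = h.toAlgHom x :=
    congrArg Subtype.val (e.apply_symm_apply ⟨h.toAlgHom x, hX x⟩)
  exact ⟨ChainStructure.homMk k (fun n a => hg (by rw [hk, map_proj, map_proj, hk]))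
    (fun a => hg (by rw [hk, g.map_d, h.map_d, hk])), hom_ext hk⟩

/-- Every cocone on `F` factors through the chain subalgebra generated by the images of all `F.obj
j`. An adjoint of the diagonal functor then gives colimits. -/
theorem solutionSetCondition_const (J : Type u) [Category.{u} J] :
    SolutionSetCondition.{u} (Functor.const J : ChainAlgebra K ⥤ J ⥤ ChainAlgebra K) := by
  intro F
  refine ⟨Σ i : GeneratedIndex K (Σ j, F.obj j), (F ⟶ (Functor.const J).obj i.obj),
    fun i => i.1.obj, fun i => i.2, fun X h => ?_⟩
  obtain ⟨i, g, hg, hX⟩ := exists_generated (A := X)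
    (fun x : Σ j, F.obj j => (h.app x.1).toAlgHom x.2)
  choose k hk using fun j => exists_factor (h.app j) g hg fun x => hX ⟨j, x⟩
  refine ⟨⟨i, { app := k, naturality := fun j j' f => ?_ }⟩, g, ?_⟩
  · refine hom_ext fun x => hg ?_
    have h₁ := hom_congr (hk j') ((F.map f).toAlgHom x)
    have h₂ := hom_congr (hk j) x
    have h₃ := hom_congr (h.naturality f) x
    exact h₁.trans (h₃.trans h₂.symm)
  · ext j
    exact hk j

instance : HasColimitsOfSize.{u, u} (ChainAlgebra K) where
  has_colimits_of_shape J _ := hasColimitsOfShape_iff_isRightAdjoint_const.2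
    (isRightAdjoint_of_preservesLimits_of_solutionSetCondition _ (solutionSetCondition_const J))

/-! ### Free chain algebras on one generator -/

theorem solutionSetCondition_homogeneousFunctor (n : ℕ) (P : Prop) :
    SolutionSetCondition.{u} (homogeneousFunctor K n P) := by
  intro S
  refine ⟨Σ i : GeneratedIndex K S, (S ⟶ (homogeneousFunctor K n P).obj i.obj),
    fun i => i.1.obj, fun i => i.2, fun X h => ?_⟩
  obtain ⟨i, g, hg, hX⟩ := exists_generated (A := X) (fun s : S => (h s).1)
  choose k hk using hX
  refine ⟨⟨i, TypeCat.ofHom fun s => ⟨k s, ?_⟩⟩, g, ?_⟩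
  · refine mem_homogeneous_of_injective (fun _ : Unit => g) (fun x y h => hg (h ())) fun _ => ?_
    exact (hk s).symm ▸ (h s).2
  · ext s
    exact Subtype.ext (hk s)

instance (n : ℕ) (P : Prop) : (homogeneousFunctor K n P).IsRightAdjoint :=
  isRightAdjoint_of_preservesLimits_of_solutionSetCondition _
    (solutionSetCondition_homogeneousFunctor n P)

variable (K) in
/-- The free chain algebra on a generator of degree `n`, which is a cycle if `P` holds. -/
noncomputable def free (n : ℕ) (P : Prop) : ChainAlgebra K :=
  (homogeneousFunctor K n P).leftAdjoint.obj PUnit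

variable (K) in
/-- The generator of the free chain algebra. -/
noncomputable def gen (n : ℕ) (P : Prop) : (free K n P).homogeneous n P :=
  (Adjunction.ofIsRightAdjoint (homogeneousFunctor K n P)).unit.app PUnit PUnit.unit

section

variable {n : ℕ} {P : Prop} {A : ChainAlgebra K}

/-- The homomorphism from the free chain algebra with given value on the generator. -/
noncomputable def freeDesc (a : A.homogeneous n P) : free K n P ⟶ A :=
  ((Adjunction.ofIsRightAdjoint (homogeneousFunctor K n P)).homEquiv PUnit A).symm
    (TypeCat.ofHom fun _ => a)

theorem homEquiv_apply (f : free K n P ⟶ A) :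
    (((Adjunction.ofIsRightAdjoint (homogeneousFunctor K n P)).homEquiv PUnit A) f
      PUnit.unit).1 = f.toAlgHom (gen K n P).1 :=
  congrArg Subtype.val (ConcreteCategory.congr_hom
    (Adjunction.homEquiv_unit (Adjunction.ofIsRightAdjoint (homogeneousFunctor K n P))
      (X := PUnit) (f := f)) PUnit.unit)

theorem freeDesc_gen (a : A.homogeneous n P) : (freeDesc a).toAlgHom (gen K n P).1 = a.1 := by
  rw [← homEquiv_apply, freeDesc, Equiv.apply_symm_apply]
  rfl

theorem free_hom_ext {f g : free K n P ⟶ A}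
    (h : f.toAlgHom (gen K n P).1 = g.toAlgHom (gen K n P).1) : f = g := by
  apply ((Adjunction.ofIsRightAdjoint (homogeneousFunctor K n P)).homEquiv PUnit A).injective
  ext x
  apply Subtype.ext
  rw [← homEquiv_apply, ← homEquiv_apply] at h
  exact h

end

end ChainAlgebra

/-! ## Directed colimits of chain algebras and smallness -/

namespace ChainAlgebra

variable {K : Type u} [CommRing K]

open GradedAlg

theorem cocone_w {J : Type u} [Category.{u} J] {F : J ⥤ ChainAlgebra K} (s : Cocone F) {i j : J}
    (f : i ⟶ j) (x : F.obj i) :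
    (s.ι.app j).toAlgHom ((F.map f).toAlgHom x) = (s.ι.app i).toAlgHom x :=
  hom_congr (s.w f) x

section DirectLimit

variable {J : Type u} [LinearOrder J] [Nonempty J] (F : J ⥤ ChainAlgebra K)

/-- The transition maps of a directed system. -/
abbrev transition (i j : J) (h : i ≤ j) : F.obj i →ₐ[K] F.obj j := (F.map (homOfLE h)).toAlgHom

instance : DirectedSystem (fun j => F.obj j) (transition F · · ·) where
  map_self i x := hom_congr (F.map_id i) x
  map_map _ _ _ hij hjk x := (hom_congr (F.map_comp (homOfLE hij) (homOfLE hjk)) x).symm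

/-- The underlying ring of the directed colimit. -/
abbrev DirLim : Type u := DirectLimit (fun j => F.obj j) (transition F)

noncomputable instance : Algebra K (DirLim F) :=
  Algebra.ofModule
    (fun r => DirectLimit.induction₂ _ fun i x y => by
      simp only [DirectLimit.mul_def, DirectLimit.smul_def, smul_mul_assoc])
    (fun r => DirectLimit.induction₂ _ fun i x y => by
      simp only [DirectLimit.mul_def, DirectLimit.smul_def, mul_smul_comm])

variable {F} in
/-- The operator on the directed colimit induced by compatible operators. -/
noncomputable def dirLimMap (g : ∀ i, F.obj i →ₗ[K] F.obj i)
    (hg : ∀ i j (h : i ≤ j) x, transition F i j h (g i x) = g j (transition F i j h x)) :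
    DirLim F →ₗ[K] DirLim F where
  toFun := DirectLimit.map _ _ (fun i x => g i x) hg
  map_add' := DirectLimit.induction₂ _ fun i x y => by
    simp only [DirectLimit.add_def, DirectLimit.map_def, map_add]
  map_smul' r := DirectLimit.induction _ fun i x => by
    simp only [DirectLimit.smul_def, DirectLimit.map_def, map_smul, RingHom.id_apply]

/-- The canonical algebra homomorphism to the directed colimit. -/
noncomputable def dirLimι (i : J) : F.obj i →ₐ[K] DirLim F :=
  AlgHom.ofLinearMap
    { toFun := fun x => ⟦⟨i, x⟩⟧
      map_add' := fun x y => (DirectLimit.add_def (f := transition F) i x y).symm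
      map_smul' := fun r x => (DirectLimit.smul_def (f := transition F) i x r).symm }
    (DirectLimit.one_def (f := transition F) i).symm (fun x y => (DirectLimit.mul_def (f := transition F) i x y).symm)

theorem dirLimι_transition {i j : J} (h : i ≤ j) (x : F.obj i) :
    dirLimι F j (transition F i j h x) = dirLimι F i x :=
  (DirectLimit.eq_of_le (F := fun j => F.obj j) (f := transition F) ⟨i, x⟩ j h).symm

theorem dirLimMap_ι (g : ∀ i, F.obj i →ₗ[K] F.obj i)
    (hg : ∀ i j (h : i ≤ j) x, transition F i j h (g i x) = g j (transition F i j h x)) (i : J)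
    (x : F.obj i) : dirLimMap g hg (dirLimι F i x) = dirLimι F i (g i x) := rfl

theorem exists_dirLimι (x : DirLim F) : ∃ i y, x = dirLimι F i y := DirectLimit.exists_eq_mk _ x

theorem exists_dirLimι₂ (x y : DirLim F) :
    ∃ i a b, x = dirLimι F i a ∧ y = dirLimι F i b := DirectLimit.exists_eq_mk₂ _ x y

theorem dirLimι_eq_zero {i : J} {x : F.obj i} (h : dirLimι F i x = 0) :
    ∃ j, ∃ hij : i ≤ j, transition F i j hij x = 0 := by
  have h' : dirLimι F i x = dirLimι F i 0 := by rw [h, map_zero]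
  obtain ⟨j, h₁, h₂, h₃⟩ := Quotient.exact h'
  exact ⟨j, h₁, h₃.trans (map_zero _)⟩

/-- The chain structure on the directed colimit. -/
noncomputable def dirLimStructure : ChainStructure K (DirLim F) where
  p n := dirLimMap (fun i => (F.obj i).proj n) fun _ _ _ _ => map_proj _ _ _
  d := dirLimMap (fun i => (F.obj i).d) fun _ _ h _ => (F.map (homOfLE h)).map_d _
  p_one := by
    obtain ⟨i⟩ := ‹Nonempty J›
    rw [← map_one (dirLimι F i), dirLimMap_ι, proj_zero_one]
  p_mul m n x y := by
    obtain ⟨i, x, y, rfl, rfl⟩ := exists_dirLimι₂ F x y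
    simp only [dirLimMap_ι, ← map_mul]
    rw [proj_of_mem (GradedAlg.mul_mem (proj_mem _ _ _) (proj_mem _ _ _))]
  p_p_self n x := by
    obtain ⟨i, x, rfl⟩ := exists_dirLimι F x
    simp only [dirLimMap_ι, proj_proj_self]
  p_p_ne m n x h := by
    obtain ⟨i, x, rfl⟩ := exists_dirLimι F x
    simp only [dirLimMap_ι, proj_proj_ne h, map_zero]
  exists_sum_eq x := by
    obtain ⟨i, x, rfl⟩ := exists_dirLimι F x
    obtain ⟨N, hN⟩ := exists_proj_eq_zero x
    refine ⟨N, ?_⟩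
    simp only [dirLimMap_ι, ← map_sum, sum_proj hN]
  p_d_p n x := by
    obtain ⟨i, x, rfl⟩ := exists_dirLimι F x
    simp only [dirLimMap_ι, proj_d, proj_proj_self]
  d_p_zero x := by
    obtain ⟨i, x, rfl⟩ := exists_dirLimι F x
    simp only [dirLimMap_ι, d_proj_zero, map_zero]
  d_d x := by
    obtain ⟨i, x, rfl⟩ := exists_dirLimι F x
    simp only [dirLimMap_ι, ChainAlgebra.d_d, map_zero]
  leibniz n x y := by
    obtain ⟨i, x, y, rfl, rfl⟩ := exists_dirLimι₂ F x y
    simp only [dirLimMap_ι, ← map_mul, (F.obj i).leibniz n _ _ (proj_mem _ _ _)]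
    simp only [map_add, map_mul, map_pow, map_neg, map_one]

/-- The directed colimit cocone. -/
noncomputable def dirLimCocone : Cocone F where
  pt := (dirLimStructure F).toChainAlgebra
  ι :=
    { app := fun i => (dirLimStructure F).homTo (dirLimι F i) (fun _ _ => rfl) (fun _ => rfl)
      naturality := fun _ _ f => hom_ext fun x => dirLimι_transition F (leOfHom f) x }

/-- The homomorphism from the directed colimit to a cocone. -/
noncomputable def dirLimDesc (s : Cocone F) : DirLim F →ₐ[K] s.pt :=
  AlgHom.ofLinearMap
    { toFun := DirectLimit.lift _ (fun i x => (s.ι.app i).toAlgHom x)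
        fun i j h x => (cocone_w s (homOfLE h) x).symm
      map_add' := DirectLimit.induction₂ _ fun i x y => by
        simp only [DirectLimit.add_def, DirectLimit.lift_def]
        exact map_add _ _ _
      map_smul' := fun r => DirectLimit.induction _ fun i x => by
        simp only [DirectLimit.smul_def, DirectLimit.lift_def]
        exact map_smul _ _ _ }
    (by
      obtain ⟨i⟩ := ‹Nonempty J›
      rw [DirectLimit.one_def i]
      exact map_one (s.ι.app i).toAlgHom)
    (DirectLimit.induction₂ _ fun i x y => by
      simp only [DirectLimit.mul_def]
      exact map_mul (s.ι.app i).toAlgHom x y)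

/-- The directed colimit cocone is a colimit. -/
noncomputable def dirLimCoconeIsColimit : IsColimit (dirLimCocone F) where
  desc s := (dirLimStructure F).homFrom (dirLimDesc F s)
    (fun n x => by
      obtain ⟨i, x, rfl⟩ := exists_dirLimι F x
      exact map_proj (s.ι.app i) n x)
    (fun x => by
      obtain ⟨i, x, rfl⟩ := exists_dirLimι F x
      exact (s.ι.app i).map_d x)
  fac s j := rfl
  uniq s m hm := hom_ext fun x => by
    obtain ⟨i, x, rfl⟩ := exists_dirLimι F x
    exact hom_congr (hm i) x

variable {F} {c : Cocone F} (hc : IsColimit c)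

include hc

theorem exists_of_isColimit (x : c.pt) : ∃ i y, (c.ι.app i).toAlgHom y = x := by
  let e := hc.coconePointUniqueUpToIso (dirLimCoconeIsColimit F)
  obtain ⟨i, y, hy⟩ := exists_dirLimι F (e.hom.toAlgHom x)
  refine ⟨i, y, ?_⟩
  have h₁ := hom_congr (hc.comp_coconePointUniqueUpToIso_inv (dirLimCoconeIsColimit F) i) y
  have h₂ := hom_congr e.hom_inv_id x
  refine h₁.symm.trans (Eq.trans ?_ h₂)
  exact congrArg e.inv.toAlgHom hy.symm

theorem map_eq_zero_of_isColimit {i : J} {x : F.obj i} (h : (c.ι.app i).toAlgHom x = 0) :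
    ∃ j, ∃ f : i ⟶ j, (F.map f).toAlgHom x = 0 := by
  have h₁ := hom_congr (hc.fac (dirLimCocone F) i) x
  have h₂ : dirLimι F i x = 0 := by
    refine h₁.symm.trans ?_
    rw [comp_apply, h]
    exact map_zero _
  obtain ⟨j, hij, hj⟩ := dirLimι_eq_zero F h₂
  exact ⟨j, homOfLE hij, hj⟩

end DirectLimit

section Small

variable {J : Type u} [LinearOrder J] [Nonempty J]

/-- Homomorphisms from `free K n P` are elements of degree `n` subject to at most one equation, and
both elements and equations in a directed colimit already occur at some stage. -/
theorem preservesColimit_free (F : J ⥤ ChainAlgebra K) (n : ℕ) (P : Prop) :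
    PreservesColimit F (coyoneda.obj (Opposite.op (free K n P))) := by
  refine ⟨fun {c} hc => ⟨Types.FilteredColimit.isColimitOf' (F ⋙ coyoneda.obj _) (Functor.mapCocone _ c) (fun g => ?_)
    fun i f g h => ?_⟩⟩
  · change free K n P ⟶ c.pt at g
    have hg := map_mem_homogeneous g (gen K n P).2
    obtain ⟨i, y, hy⟩ := exists_of_isColimit hc (g.toAlgHom (gen K n P).1)
    -- The representative is a cycle only in the colimit, so one moves to a later stage where its
    -- differential vanishes.
    obtain ⟨j, f, hf⟩ : ∃ j, ∃ f : i ⟶ j, P → (F.map f).toAlgHom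
        ((F.obj i).d ((F.obj i).proj n y)) = 0 := by
      by_cases hP : P
      · obtain ⟨j, f, hf⟩ := map_eq_zero_of_isColimit hc
          (x := (F.obj i).d ((F.obj i).proj n y)) (by
            refine ((c.ι.app i).map_d _).trans ?_
            erw [map_proj, hy, proj_of_mem hg.1]
            exact hg.2 hP)
        exact ⟨j, f, fun _ => hf⟩
      · exact ⟨i, 𝟙 i, fun h => absurd h hP⟩
    refine ⟨j, freeDesc ⟨(F.map f).toAlgHom ((F.obj i).proj n y), (F.map f).map_deg _ _
      (proj_mem _ _ _), fun hP => ?_⟩, free_hom_ext ?_⟩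
    · rw [← (F.map f).map_d, hf hP]
    · refine Eq.symm ((congrArg (c.ι.app j).toAlgHom (freeDesc_gen _)).trans ?_)
      refine (cocone_w c f _).trans ?_
      erw [map_proj, hy]
      exact proj_of_mem hg.1
  · change free K n P ⟶ F.obj i at f g
    have h' := hom_congr (show f ≫ c.ι.app i = g ≫ c.ι.app i from h) (gen K n P).1
    obtain ⟨j, a, ha⟩ := map_eq_zero_of_isColimit hc
      (x := f.toAlgHom (gen K n P).1 - g.toAlgHom (gen K n P).1) (by
        erw [map_sub]
        exact sub_eq_zero.2 h')
    refine ⟨j, a, free_hom_ext (K := K) (f := f ≫ F.map a) (g := g ≫ F.map a) ?_⟩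
    rw [map_sub] at ha
    exact sub_eq_zero.1 ha

theorem preservesColimit_initial (F : J ⥤ ChainAlgebra K) {A : ChainAlgebra K}
    (hA : IsInitial A) : PreservesColimit F (coyoneda.obj (Opposite.op A)) := by
  refine ⟨fun {c} hc => ⟨Types.FilteredColimit.isColimitOf' (F ⋙ coyoneda.obj _) (Functor.mapCocone _ c) (fun g => ?_)
    fun i f g h => ⟨i, 𝟙 i, ?_⟩⟩⟩
  · obtain ⟨i⟩ := ‹Nonempty J›
    exact ⟨i, hA.to _, hA.hom_ext _ _⟩
  · exact hA.hom_ext _ _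

end Small

end ChainAlgebra

/-! ## Generating cofibrations -/

namespace ChainAlgebra

variable {K : Type u} [CommRing K]

open GradedAlg

/-! ### Elementwise criteria in homology and two-out-of-three. -/

section Homology

variable {A B C : ChainAlgebra K}

/-- The homology class of a cycle. -/
abbrev homologyMk {n : ℕ} (a : A.cycles n) : A.homology n := Submodule.Quotient.mk a

theorem homology_mk_eq_zero_iff {n : ℕ} {a : A.cycles n} :
    homologyMk a = 0 ↔ a.1 ∈ A.boundaries n :=
  Submodule.Quotient.mk_eq_zero ((A.boundaries n).submoduleOf (A.cycles n))

theorem homology_mk_eq_iff {n : ℕ} {a b : A.cycles n} :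
    homologyMk a = homologyMk b ↔ a.1 - b.1 ∈ A.boundaries n :=
  Submodule.Quotient.eq ((A.boundaries n).submoduleOf (A.cycles n))

theorem bijective_homologyMap_iff (f : A ⟶ B) (n : ℕ) :
    Function.Bijective (homologyMap f n) ↔
      (∀ a ∈ A.cycles n, f.toAlgHom a ∈ B.boundaries n → a ∈ A.boundaries n) ∧
      ∀ b ∈ B.cycles n, ∃ a ∈ A.cycles n, b - f.toAlgHom a ∈ B.boundaries n := by
  refine and_congr ?_ ⟨fun h b hb => ?_, fun h y => ?_⟩
  · rw [injective_iff_map_eq_zero]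
    refine ⟨fun h a ha hb => ?_, fun h x hx => ?_⟩
    · exact homology_mk_eq_zero_iff.1 (h (homologyMk ⟨a, ha⟩) (homology_mk_eq_zero_iff.2 hb))
    · obtain ⟨⟨a, ha⟩, rfl⟩ := Submodule.Quotient.mk_surjective _ x
      exact homology_mk_eq_zero_iff.2 (h a ha (homology_mk_eq_zero_iff.1 hx))
  · obtain ⟨x, hx⟩ := h (homologyMk ⟨b, hb⟩)
    obtain ⟨⟨a, ha⟩, rfl⟩ := Submodule.Quotient.mk_surjective _ x
    exact ⟨a, ha, homology_mk_eq_iff.1 hx.symm⟩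
  · obtain ⟨⟨b, hb⟩, rfl⟩ := Submodule.Quotient.mk_surjective _ y
    obtain ⟨a, ha, hab⟩ := h b hb
    exact ⟨homologyMk ⟨a, ha⟩, (homology_mk_eq_iff.2 hab).symm⟩

theorem homologyMap_comp (f : A ⟶ B) (g : B ⟶ C) (n : ℕ) :
    ⇑(homologyMap (f ≫ g) n) = homologyMap g n ∘ homologyMap f n := by
  funext x
  obtain ⟨a, rfl⟩ := Submodule.Quotient.mk_surjective _ x
  rfl

theorem homologyMap_id (n : ℕ) : ⇑(homologyMap (𝟙 A) n) = id := by
  funext x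
  obtain ⟨a, rfl⟩ := Submodule.Quotient.mk_surjective _ x
  rfl

instance : (weakEquivalences K).IsMultiplicative where
  id_mem A n := by
    rw [homologyMap_id]
    exact Function.bijective_id
  comp_mem f g hf hg n := by
    rw [homologyMap_comp]
    exact (hg n).comp (hf n)

instance : (weakEquivalences K).HasTwoOutOfThreeProperty where
  of_postcomp f g hg hfg n := by
    have := hfg n
    rw [homologyMap_comp] at this
    exact (Function.Bijective.of_comp_iff' (hg n) _).1 this
  of_precomp f g hf hfg n := by
    have := hfg n
    rw [homologyMap_comp] at this
    exact (Function.Bijective.of_comp_iff _ (hf n)).1 this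

end Homology

variable (K) in
/-- The inclusion of the free chain algebra on a cycle of degree `n` into the free chain algebra
on an element of degree `n + 1`. -/
noncomputable def sphereToDisk (n : ℕ) : free K n True ⟶ free K (n + 1) False :=
  freeDesc ⟨(free K (n + 1) False).d (gen K (n + 1) False).1,
    (free K (n + 1) False).d_mem _ _ (gen K (n + 1) False).2.1,
    fun _ => (free K (n + 1) False).d_d _⟩

theorem sphereToDisk_gen (n : ℕ) : (sphereToDisk K n).toAlgHom (gen K n True).1 =
    (free K (n + 1) False).d (gen K (n + 1) False).1 := freeDesc_gen _

/-! ### Lifting problems against the generators as equations. -/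

section Lifting

variable {E F : ChainAlgebra K} (p : E ⟶ F)

/-- A commutative square is exactly a cycle `z` of `E` with an element `y` of `F` bounding its
image; a lift is an element over `y` bounding `z`. -/
theorem hasLiftingProperty_sphereToDisk_iff (n : ℕ) :
    HasLiftingProperty (sphereToDisk K n) p ↔
      ∀ z ∈ E.cycles n, ∀ y ∈ F.deg (n + 1), F.d y = p.toAlgHom z →
        ∃ e ∈ E.deg (n + 1), E.d e = z ∧ p.toAlgHom e = y := by
  constructor
  · intro h z hz y hy hyz
    have sq : CommSq (freeDesc ⟨z, hz.1, fun _ => hz.2⟩) (sphereToDisk K n) p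
        (freeDesc ⟨y, hy, False.elim⟩) := ⟨free_hom_ext <| by
      rw [comp_apply, comp_apply, freeDesc_gen, sphereToDisk_gen, Hom.map_d, freeDesc_gen, hyz]⟩
    refine ⟨sq.lift.toAlgHom (gen K (n + 1) False).1, sq.lift.map_deg _ _
      (gen K (n + 1) False).2.1, ?_, ?_⟩
    · rw [← sq.lift.map_d, ← sphereToDisk_gen, ← comp_apply, sq.fac_left, freeDesc_gen]
    · rw [← comp_apply, sq.fac_right, freeDesc_gen]
  · refine fun h => ⟨fun {f g} sq => ?_⟩
    have hf := map_mem_homogeneous f (gen K n True).2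
    have hg := map_mem_homogeneous g (gen K (n + 1) False).2
    obtain ⟨e, he, hez, hey⟩ := h _ ⟨hf.1, hf.2 trivial⟩ _ hg.1 (by
      rw [← comp_apply f p, sq.w, comp_apply, sphereToDisk_gen, g.map_d])
    refine ⟨⟨⟨freeDesc ⟨e, he, False.elim⟩, free_hom_ext ?_, free_hom_ext ?_⟩⟩⟩
    · rw [comp_apply, sphereToDisk_gen, Hom.map_d, freeDesc_gen, hez]
    · rw [comp_apply, freeDesc_gen, hey]

theorem hasLiftingProperty_initial_iff {A : ChainAlgebra K} (hA : IsInitial A) (n : ℕ) (P : Prop) :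
    HasLiftingProperty (hA.to (free K n P)) p ↔
      ∀ y ∈ F.homogeneous n P, ∃ e ∈ E.homogeneous n P, p.toAlgHom e = y := by
  constructor
  · intro h y hy
    have sq : CommSq (hA.to E) (hA.to (free K n P)) p (freeDesc ⟨y, hy⟩) := ⟨hA.hom_ext _ _⟩
    refine ⟨sq.lift.toAlgHom (gen K n P).1, map_mem_homogeneous _ (gen K n P).2, ?_⟩
    rw [← comp_apply, sq.fac_right, freeDesc_gen]
  · refine fun h => ⟨fun {f g} sq => ?_⟩
    obtain ⟨e, he, hey⟩ := h _ (map_mem_homogeneous g (gen K n P).2)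
    refine ⟨⟨⟨freeDesc ⟨e, he⟩, hA.hom_ext _ _, free_hom_ext ?_⟩⟩⟩
    rw [comp_apply, freeDesc_gen, hey]

end Lifting

variable (K) in
/-- The domains of the generating cofibrations. -/
noncomputable def generatingCofibrationDom : Option ℕ → ChainAlgebra K
  | none => ⊥_ _
  | some n => free K n True

variable (K) in
/-- The codomains of the generating cofibrations. -/
noncomputable def generatingCofibrationCod : Option ℕ → ChainAlgebra K
  | none => free K 0 True
  | some n => free K (n + 1) False

variable (K) in
/-- The family of generating cofibrations. -/
noncomputable def generatingCofibration :
    ∀ i, generatingCofibrationDom K i ⟶ generatingCofibrationCod K i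
  | none => initialIsInitial.to _
  | some n => sphereToDisk K n

variable (K) in
/-- The generating cofibrations. -/
abbrev generatingCofibrations : MorphismProperty (ChainAlgebra K) :=
  .ofHoms (generatingCofibration K)

variable (K) in
/-- The generating trivial cofibrations. -/
abbrev generatingTrivialCofibrations : MorphismProperty (ChainAlgebra K) :=
  .ofHoms fun n : ℕ => initialIsInitial.to (free K (n + 1) False)

theorem generatingCofibrations_rlp_iff {E F : ChainAlgebra K} (p : E ⟶ F) :
    (generatingCofibrations K).rlp p ↔
      (∀ y ∈ F.deg 0, ∃ e ∈ E.deg 0, p.toAlgHom e = y) ∧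
      ∀ n, ∀ z ∈ E.cycles n, ∀ y ∈ F.deg (n + 1), F.d y = p.toAlgHom z →
        ∃ e ∈ E.deg (n + 1), E.d e = z ∧ p.toAlgHom e = y := by
  have h₁ : (generatingCofibrations K).rlp p ↔
      ∀ i, HasLiftingProperty (generatingCofibration K i) p :=
    ⟨fun h i => h _ ⟨i⟩, by rintro h _ _ _ ⟨i⟩; exact h i⟩
  rw [h₁, Option.forall]
  refine and_congr ((hasLiftingProperty_initial_iff p initialIsInitial 0 True).trans ?_)
    (forall_congr' fun n => hasLiftingProperty_sphereToDisk_iff p n)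
  exact ⟨fun h y hy => (h y ⟨hy, fun _ => F.d_zero y hy⟩).imp fun e he => ⟨he.1.1, he.2⟩,
    fun h y hy => (h y hy.1).imp fun e he => ⟨⟨he.1, fun _ => E.d_zero e he.1⟩, he.2⟩⟩

variable (K) in
theorem generatingTrivialCofibrations_rlp :
    (generatingTrivialCofibrations K).rlp = fibrations K := by
  ext E F p
  have h₁ : (generatingTrivialCofibrations K).rlp p ↔
      ∀ n : ℕ, HasLiftingProperty (initialIsInitial.to (free K (n + 1) False)) p :=
    ⟨fun h i => h _ ⟨i⟩, by rintro h _ _ _ ⟨i⟩; exact h i⟩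
  rw [h₁]
  simp only [hasLiftingProperty_initial_iff]
  constructor
  · rintro h (_ | n) hn y hy
    · omega
    · exact (h n y ⟨hy, False.elim⟩).imp fun e he => ⟨he.1.1, he.2⟩
  · exact fun h n y hy => (h (n + 1) n.succ_pos y hy.1).imp fun e he => ⟨⟨he.1, False.elim⟩, he.2⟩

-- In both directions the intermediate fact is that `p` is surjective on cycles of every degree,
-- including degree 0, where every element is a cycle.
variable (K) in
theorem generatingCofibrations_rlp :
    (generatingCofibrations K).rlp = fibrations K ⊓ weakEquivalences K := by
  ext E F p
  rw [generatingCofibrations_rlp_iff]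
  constructor
  · rintro ⟨h₀, h⟩
    have hcycles (n : ℕ) (y) (hy : y ∈ F.cycles n) : ∃ e ∈ E.cycles n, p.toAlgHom e = y := by
      obtain _ | n := n
      · obtain ⟨e, he, hey⟩ := h₀ y hy.1
        exact ⟨e, ⟨he, E.d_zero e he⟩, hey⟩
      · obtain ⟨e, he, hez, hey⟩ := h n 0 (zero_mem _) y hy.1 (by rw [map_zero]; exact hy.2)
        exact ⟨e, ⟨he, hez⟩, hey⟩
    refine ⟨fun n hn y hy => ?_, fun n => (bijective_homologyMap_iff p n).2 ⟨?_, ?_⟩⟩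
    · obtain ⟨n, rfl⟩ := Nat.exists_eq_succ_of_ne_zero hn.ne'
      obtain ⟨z, hz, hzy⟩ := hcycles n (F.d y) ⟨F.d_mem _ _ hy, F.d_d y⟩
      obtain ⟨e, he, -, hey⟩ := h n z hz y hy hzy.symm
      exact ⟨e, he, hey⟩
    · rintro a ha ⟨y, hy, hya⟩
      obtain ⟨e, he, hea, -⟩ := h n a ha y hy hya
      exact ⟨e, he, hea⟩
    · intro b hb
      obtain ⟨e, he, heb⟩ := hcycles n b hb
      exact ⟨e, he, by rw [heb, sub_self]; exact zero_mem _⟩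
  · rintro ⟨hfib, hw⟩
    replace hw n := (bijective_homologyMap_iff p n).1 (hw n)
    -- Surjectivity in homology lifts `y` up to a boundary `F.d x`; as `x` has positive degree, it
    -- lifts along the fibration and corrects the error.
    have hcycles (n : ℕ) (y) (hy : y ∈ F.cycles n) : ∃ e ∈ E.cycles n, p.toAlgHom e = y := by
      obtain ⟨a, ha, x, hx, hxa⟩ := (hw n).2 y hy
      obtain ⟨w, hw, rfl⟩ := hfib (n + 1) n.succ_pos x hx
      refine ⟨a + E.d w, add_mem ha ⟨E.d_mem _ _ hw, E.d_d w⟩, ?_⟩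
      rw [map_add, p.map_d, hxa]
      abel
    refine ⟨fun y hy => ?_, fun n z hz y hy hyz => ?_⟩
    · obtain ⟨e, he, hey⟩ := hcycles 0 y ⟨hy, F.d_zero y hy⟩
      exact ⟨e, he.1, hey⟩
    -- Injectivity in homology makes `z` a boundary `E.d x`; then `y - p x` is a cycle, and adding a
    -- cycle lifting it to `x` does not change the boundary.
    · obtain ⟨x, hx, hxz⟩ := (hw n).1 z hz ⟨y, hy, hyz⟩
      obtain ⟨c, hc, hcy⟩ := hcycles (n + 1) (y - p.toAlgHom x)
        ⟨sub_mem hy (p.map_deg _ _ hx), by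
          change F.d _ = 0
          rw [map_sub, hyz, ← p.map_d, hxz, sub_self]⟩
      refine ⟨x + c, add_mem hx hc.1, ?_, ?_⟩
      · rw [map_add, hxz, show E.d c = 0 from hc.2, add_zero]
      · rw [map_add, hcy]
        abel

end ChainAlgebra

/-! ## Mapping path algebras -/

namespace GradedAlg

variable {K : Type u} [CommRing K] {A : GradedAlg K}

variable (A) in
/-- The linear map multiplying elements of degree `n` by `(-1) ^ n`. -/
noncomputable def signLinear : A →ₗ[K] A :=
  (DirectSum.toModule K ℕ A fun n => (-1 : K) ^ n • (A.deg n).subtype).comp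
    (DirectSum.decomposeLinearEquiv A.deg).toLinearMap

theorem signLinear_of_mem {n : ℕ} {a : A} (h : a ∈ A.deg n) :
    A.signLinear a = (-1 : K) ^ n • a := by
  change DirectSum.toModule K ℕ A (fun n => (-1 : K) ^ n • (A.deg n).subtype)
    (DirectSum.decompose A.deg a) = _
  rw [DirectSum.decompose_of_mem A.deg h]
  exact DirectSum.toModule_lof K n _

variable (A) in
/-- The algebra automorphism multiplying elements of degree `n` by `(-1) ^ n`. -/
noncomputable def sign : A →ₐ[K] A :=
  AlgHom.ofLinearMap A.signLinear (by rw [signLinear_of_mem one_mem, pow_zero, one_smul])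
    fun x y => by
      refine homogeneous_induction x ?_ (fun m x hx => ?_) (fun x x' hx hx' => ?_)
      · simp
      · refine homogeneous_induction y ?_ (fun n y hy => ?_) (fun y y' hy hy' => ?_)
        · simp
        · rw [signLinear_of_mem hx, signLinear_of_mem hy, signLinear_of_mem (mul_mem hx hy),
            smul_mul_smul_comm, pow_add]
        · simp only [mul_add, map_add, hy, hy']
      · simp only [add_mul, map_add, hx, hx']

theorem sign_of_mem {n : ℕ} {a : A} (h : a ∈ A.deg n) : A.sign a = (-1 : K) ^ n • a :=
  signLinear_of_mem h

theorem sign_proj (n : ℕ) (a : A) : A.sign (A.proj n a) = (-1 : K) ^ n • A.proj n a :=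
  sign_of_mem (A.proj_mem n a)

theorem proj_sign (n : ℕ) (a : A) : A.proj n (A.sign a) = (-1 : K) ^ n • A.proj n a := by
  refine homogeneous_induction a ?_ (fun m x hx => ?_) (fun x x' hx hx' => ?_)
  · simp
  · rw [sign_of_mem hx, map_smul]
    by_cases h : m = n
    · rw [h]
    · rw [proj_of_mem_ne hx h, smul_zero, smul_zero]
  · simp only [map_add, hx, hx', smul_add]

theorem sign_sign (a : A) : A.sign (A.sign a) = a := by
  refine ext_proj fun n => ?_
  rw [proj_sign, proj_sign, smul_smul, ← mul_pow, neg_one_mul, neg_neg, one_pow, one_smul]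

theorem neg_one_pow_mul (n : ℕ) (a : A) : (-1) ^ n * a = (-1 : K) ^ n • a := by
  rw [Algebra.smul_def, map_pow, map_neg, map_one]

theorem proj_one_mul (x y : A) :
    A.proj 1 (x * y) = A.proj 0 x * A.proj 1 y + A.proj 1 x * A.proj 0 y := by
  simp [proj_mul, Finset.Nat.antidiagonal_succ]

theorem proj_zero_algebraMap (r : K) : A.proj 0 (algebraMap K A r) = algebraMap K A r := by
  rw [Algebra.algebraMap_eq_smul_one, map_smul, proj_zero_one]

end GradedAlg

namespace ChainAlgebra

variable {K : Type u} [CommRing K]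

open GradedAlg

theorem sign_d (A : ChainAlgebra K) (a : A) : A.sign (A.d a) = -A.d (A.sign a) := by
  refine ext_proj fun n => ?_
  rw [proj_sign, proj_d, map_neg, proj_d, proj_sign, map_smul, pow_succ, mul_neg_one, neg_smul,
    neg_neg]

section PathAlgebra

variable {A B : ChainAlgebra K} (f : A ⟶ B)

/-- The underlying algebra of the mapping path algebra: triples `(a, b, h)` with `h` of degree
shifted by one, realised by triangular matrices with diagonal entries `sign b` and `f a`. -/
def pathSubalgebra : Subalgebra K (A × Matrix (Fin 2) (Fin 2) B) where
  carrier := {x | x.2 1 0 = 0 ∧ x.2 1 1 = f.toAlgHom x.1 ∧ B.proj 0 (x.2 0 1) = 0 ∧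
    B.proj 0 (x.2 0 0) - B.proj 0 (f.toAlgHom x.1) = B.d (B.proj 1 (x.2 0 1))}
  mul_mem' := by
    rintro ⟨a, M⟩ ⟨a', M'⟩ ⟨h₁, h₂, h₃, h₄⟩ ⟨h₁', h₂', h₃', h₄'⟩
    dsimp only at h₁ h₂ h₃ h₄ h₁' h₂' h₃' h₄'
    simp only [Set.mem_ofPred_eq, Prod.mk_mul_mk, Matrix.mul_apply, Fin.sum_univ_two, map_mul,
      h₁, h₁', h₂, h₂', zero_mul, mul_zero, add_zero, zero_add, map_add, proj_zero_mul,
      proj_one_mul, h₃, h₃', true_and]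
    -- The degree-0 condition for a product telescopes: with b, b' and a, a' the degree-0 parts of
    -- the diagonal entries, b(b' - a') + (b - a)a' = bb' - aa'.
    rw [B.leibniz 0 _ _ (proj_mem _ _ _), B.leibniz 1 _ _ (proj_mem _ _ _), d_proj_zero,
      d_proj_zero, ← h₄, ← h₄']
    noncomm_ring
  add_mem' := by
    rintro ⟨a, M⟩ ⟨a', M'⟩ ⟨h₁, h₂, h₃, h₄⟩ ⟨h₁', h₂', h₃', h₄'⟩
    dsimp only at h₁ h₂ h₃ h₄ h₁' h₂' h₃' h₄'
    simp only [Set.mem_ofPred_eq, Prod.mk_add_mk, Matrix.add_apply, map_add, h₁, h₁', h₂, h₂', h₃,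
      h₃', ← h₄, ← h₄', add_zero, true_and]
    abel
  algebraMap_mem' r := by
    simp [Matrix.algebraMap_matrix_apply, Prod.algebraMap_apply, proj_zero_algebraMap]

namespace pathSubalgebra

variable {f}

/-- The component in the source. -/
def source (x : pathSubalgebra f) : A := x.1.1

/-- The component in the target, up to a sign. -/
def target (x : pathSubalgebra f) : B := x.1.2 0 0

/-- The path component. -/
def path (x : pathSubalgebra f) : B := x.1.2 0 1

theorem ext {x y : pathSubalgebra f} (h₁ : source x = source y) (h₂ : target x = target y)
    (h₃ : path x = path y) : x = y := by
  refine Subtype.ext (Prod.ext h₁ (Matrix.ext fun i j => ?_))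
  fin_cases i <;> fin_cases j
  · exact h₂
  · exact h₃
  · exact x.2.1.trans y.2.1.symm
  · exact x.2.2.1.trans ((congrArg f.toAlgHom h₁).trans y.2.2.1.symm)

theorem proj_zero_path (x : pathSubalgebra f) : B.proj 0 (path x) = 0 := x.2.2.2.1

theorem proj_zero_target (x : pathSubalgebra f) :
    B.proj 0 (target x) - B.proj 0 (f.toAlgHom (source x)) = B.d (B.proj 1 (path x)) := x.2.2.2.2

variable (f) in
/-- The triple with given components. -/
def ofComponents (a : A) (b h : B) (h₀ : B.proj 0 h = 0)
    (h₁ : B.proj 0 b - B.proj 0 (f.toAlgHom a) = B.d (B.proj 1 h)) : pathSubalgebra f :=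
  ⟨⟨a, !![b, h; 0, f.toAlgHom a]⟩, rfl, rfl, h₀, h₁⟩

section

variable (a : A) (b h : B) (h₀ : B.proj 0 h = 0)
  (h₁ : B.proj 0 b - B.proj 0 (f.toAlgHom a) = B.d (B.proj 1 h)) (x y : pathSubalgebra f)

@[simp] theorem source_ofComponents : source (ofComponents f a b h h₀ h₁) = a := rfl
@[simp] theorem target_ofComponents : target (ofComponents f a b h h₀ h₁) = b := rfl
@[simp] theorem path_ofComponents : path (ofComponents f a b h h₀ h₁) = h := rfl
@[simp] theorem source_add : source (x + y) = source x + source y := rfl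
@[simp] theorem target_add : target (x + y) = target x + target y := rfl
@[simp] theorem path_add : path (x + y) = path x + path y := rfl
@[simp] theorem source_smul (r : K) : source (r • x) = r • source x := rfl
@[simp] theorem target_smul (r : K) : target (r • x) = r • target x := rfl
@[simp] theorem path_smul (r : K) : path (r • x) = r • path x := rfl
@[simp] theorem source_zero : source (0 : pathSubalgebra f) = 0 := rfl
@[simp] theorem target_zero : target (0 : pathSubalgebra f) = 0 := rfl
@[simp] theorem path_zero : path (0 : pathSubalgebra f) = 0 := rfl
@[simp] theorem source_one : source (1 : pathSubalgebra f) = 1 := rfl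
@[simp] theorem target_one : target (1 : pathSubalgebra f) = 1 := rfl
@[simp] theorem path_one : path (1 : pathSubalgebra f) = 0 := rfl
@[simp] theorem source_mul : source (x * y) = source x * source y := rfl

@[simp] theorem target_mul : target (x * y) = target x * target y := by
  have h : y.1.2 1 0 = 0 := y.2.1
  simp [target, Matrix.mul_apply, h]

@[simp] theorem path_mul :
    path (x * y) = target x * path y + path x * f.toAlgHom (source y) := by
  have h : y.1.2 1 1 = f.toAlgHom y.1.1 := y.2.2.1
  simp [target, path, source, Matrix.mul_apply, h]

end

variable (f) in
/-- The components as linear maps. -/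
def sourceLinear : pathSubalgebra f →ₗ[K] A := ⟨⟨source, source_add⟩, fun r x => source_smul x r⟩

variable (f) in
/-- The component in the target as a linear map. -/
def targetLinear : pathSubalgebra f →ₗ[K] B := ⟨⟨target, target_add⟩, fun r x => target_smul x r⟩

variable (f) in
/-- The path component as a linear map. -/
def pathLinear : pathSubalgebra f →ₗ[K] B := ⟨⟨path, path_add⟩, fun r x => path_smul x r⟩

variable (f) in
/-- The homogeneous components of the mapping path algebra. -/
def proj (n : ℕ) : pathSubalgebra f →ₗ[K] pathSubalgebra f where
  -- The path component is shifted: its part of degree `n + 1` in `B` has degree `n` in the path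
  -- algebra.
  toFun x := ofComponents f (A.proj n (source x)) (B.proj n (target x)) (B.proj (n + 1) (path x))
    (proj_proj_ne n.succ_ne_zero _) (by
      rw [map_proj]
      obtain _ | n := n
      · rw [proj_proj_self, proj_proj_self, proj_proj_self, proj_zero_target]
      · rw [proj_proj_ne (by omega), proj_proj_ne (by omega), proj_proj_ne (by omega), map_zero,
          sub_zero])
  map_add' x y := ext (by simp) (by simp) (by simp)
  map_smul' r x := ext (by simp) (by simp) (by simp)

variable (f) in
/-- The differential of the mapping path algebra. -/
noncomputable def d : pathSubalgebra f →ₗ[K] pathSubalgebra f where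
  toFun x := ofComponents f (A.d (source x)) (-B.d (target x))
    (B.sign (target x) - f.toAlgHom (source x) - B.d (path x))
    -- The condition tying the degree-0 parts to `B.proj 1 (path x)` says exactly that the path
    -- component of the differential has no part in `B.deg 0`, which would have degree -1 in the
    -- path algebra.
    (by
      rw [map_sub, map_sub, proj_sign, proj_d, pow_zero, one_smul, proj_zero_target, sub_self])
    (by
      rw [map_neg, proj_d, f.map_d, proj_d, map_sub (B.proj 1), map_sub (B.proj 1), proj_sign,
        proj_d, map_sub, map_sub, B.d_d, map_smul, pow_one, neg_smul, one_smul, sub_zero])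
  map_add' x y := ext (by simp) (by simp; abel) (by simp; abel)
  map_smul' r x := ext (by simp) (by simp) (by simp [smul_sub])

@[simp] theorem source_proj (n : ℕ) (x : pathSubalgebra f) :
    source (proj f n x) = A.proj n (source x) := rfl
@[simp] theorem target_proj (n : ℕ) (x : pathSubalgebra f) :
    target (proj f n x) = B.proj n (target x) := rfl
@[simp] theorem path_proj (n : ℕ) (x : pathSubalgebra f) :
    path (proj f n x) = B.proj (n + 1) (path x) := rfl
@[simp] theorem source_d (x : pathSubalgebra f) : source (d f x) = A.d (source x) := rfl
@[simp] theorem target_d (x : pathSubalgebra f) : target (d f x) = -B.d (target x) := rfl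
@[simp] theorem path_d (x : pathSubalgebra f) :
    path (d f x) = B.sign (target x) - f.toAlgHom (source x) - B.d (path x) := rfl

end pathSubalgebra

open pathSubalgebra in
/-- The chain structure on the mapping path algebra. -/
noncomputable def pathStructure : ChainStructure K (pathSubalgebra f) where
  p := pathSubalgebra.proj f
  d := pathSubalgebra.d f
  p_one := ext proj_zero_one proj_zero_one (by simp)
  p_mul m n x y := by
    refine ext ?_ ?_ ?_
    · simpa using proj_of_mem (GradedAlg.mul_mem (proj_mem _ _ _) (proj_mem _ _ _))
    · simpa using proj_of_mem (GradedAlg.mul_mem (proj_mem _ _ _) (proj_mem _ _ _))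
    · simp only [path_proj, path_mul, source_proj, target_proj, map_proj, map_add]
      congr 1
      · rw [add_assoc]
        exact proj_of_mem (GradedAlg.mul_mem (proj_mem _ _ _) (proj_mem _ _ _))
      · rw [show m + n + 1 = m + 1 + n by omega]
        exact proj_of_mem (GradedAlg.mul_mem (proj_mem _ _ _) (proj_mem _ _ _))
  p_p_self n x := ext (proj_proj_self _ _) (proj_proj_self _ _) (proj_proj_self _ _)
  p_p_ne m n x h := ext (proj_proj_ne h _) (proj_proj_ne h _) (proj_proj_ne (by omega) _)
  exists_sum_eq x := by
    obtain ⟨N₁, h₁⟩ := exists_proj_eq_zero (source x)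
    obtain ⟨N₂, h₂⟩ := exists_proj_eq_zero (target x)
    obtain ⟨N₃, h₃⟩ := exists_proj_eq_zero (path x)
    refine ⟨N₁ + N₂ + N₃, ext ?_ ?_ ?_⟩
    · refine (map_sum (sourceLinear f) _ _).trans ?_
      exact sum_proj (N := N₁ + N₂ + N₃) fun n hn => h₁ n (by omega)
    · refine (map_sum (targetLinear f) _ _).trans ?_
      exact sum_proj (N := N₁ + N₂ + N₃) fun n hn => h₂ n (by omega)
    · refine (map_sum (pathLinear f) _ _).trans ?_
      -- Because of the shift the sum omits the degree-0 part of `path x`, which is zero.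
      have := sum_proj (a := path x) (N := N₁ + N₂ + N₃ + 1) fun n hn => h₃ n (by omega)
      rw [Finset.sum_range_succ', proj_zero_path, add_zero] at this
      exact this
  p_d_p n x := by
    refine ext ?_ ?_ ?_
    · simp [ChainAlgebra.proj_d, proj_proj_self]
    · simp [ChainAlgebra.proj_d, proj_proj_self]
    · simp [ChainAlgebra.proj_d, proj_proj_self, sign_proj, map_proj]
  d_p_zero x := by
    refine ext ?_ ?_ ?_
    · simp [d_proj_zero]
    · simp [d_proj_zero]
    · simp only [path_d, target_proj, source_proj, path_proj, sign_proj, map_proj, pow_zero,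
        one_smul, zero_add]
      rw [proj_zero_target, sub_self]
      rfl
  d_d x := by
    refine ext ?_ ?_ ?_
    · simp [ChainAlgebra.d_d]
    · simp [ChainAlgebra.d_d]
    · simp only [path_d, target_d, source_d, map_sub, map_neg, sign_d, ChainAlgebra.d_d, f.map_d,
        path_zero]
      abel
  -- Here the sign twist of the target matters: on `target (p n x)` the operator `sign` is
  -- multiplication by `(-1) ^ n`, so the mixed terms target times `f (source y)` cancel.
  leibniz n x y := by
    have key : (-1) ^ n * (pathSubalgebra.proj f n x * pathSubalgebra.d f y) =
        (-1 : K) ^ n • (pathSubalgebra.proj f n x * pathSubalgebra.d f y) := by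
      rw [Algebra.smul_def, map_pow, map_neg, map_one]
    rw [key]
    refine ext ?_ ?_ ?_
    · simp [A.leibniz n _ _ (proj_mem _ _ _), neg_one_pow_mul]
    · simp [B.leibniz n _ _ (proj_mem _ _ _), neg_one_pow_mul]
      abel
    · simp only [path_d, path_mul, target_mul, source_mul, target_proj, source_proj, path_proj,
        path_add, path_smul, source_d, target_d, map_mul, map_add, map_proj,
        B.leibniz n _ _ (proj_mem _ _ _), B.leibniz (n + 1) _ _ (proj_mem _ _ _), sign_proj,
        f.map_d, neg_one_pow_mul, pow_succ, mul_neg_one, smul_add, smul_mul_assoc,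
        mul_sub, smul_sub, sub_mul, neg_mul]
      abel

@[simp] theorem pathStructure_p (n : ℕ) : (pathStructure f).p n = pathSubalgebra.proj f n := rfl

@[simp] theorem pathStructure_d : (pathStructure f).d = pathSubalgebra.d f := rfl

/-- The mapping path algebra. -/
noncomputable abbrev pathAlgebra : ChainAlgebra K := (pathStructure f).toChainAlgebra

open pathSubalgebra in
/-- The evaluation of paths in the target. -/
noncomputable def pathEval : pathAlgebra f ⟶ B :=
  (pathStructure f).homFrom
    ((B.sign).comp (AlgHom.ofLinearMap (targetLinear f) (target_one (f := f)) target_mul))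
    (fun n x => (sign_proj n (target x)).trans (proj_sign n (target x)).symm)
    (fun x => by
      change B.sign (-B.d (target x)) = B.d (B.sign (target x))
      rw [map_neg, sign_d, neg_neg])

open pathSubalgebra in
/-- The projection to the source. -/
noncomputable def pathSource : pathAlgebra f ⟶ A :=
  (pathStructure f).homFrom
    (AlgHom.ofLinearMap (sourceLinear f) (source_one (f := f)) source_mul)
    (fun _ _ => rfl) (fun _ => rfl)

open pathSubalgebra in
/-- The inclusion of constant paths. -/
noncomputable def pathConst : A ⟶ pathAlgebra f :=
  (pathStructure f).homTo
    (AlgHom.ofLinearMap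
      { toFun := fun a => ofComponents f a (B.sign (f.toAlgHom a)) 0 (map_zero _) (by
          rw [proj_sign, pow_zero, one_smul, sub_self, map_zero, map_zero])
        map_add' := fun x y => ext (by simp) (by simp) (by simp)
        map_smul' := fun r x => ext (by simp) (by simp) (by simp) }
      (ext (by simp) (by simp) (by simp)) fun x y => ext (by simp) (by simp) (by simp))
    (fun n a => ext (by simp) (by simp [sign_proj, proj_sign, map_proj]) (by simp))
    (fun a => ext (by simp) (by simp [f.map_d, sign_d]) (by simp [sign_sign]))

theorem pathConst_eval : pathConst f ≫ pathEval f = f := hom_ext fun _ => sign_sign _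

theorem pathConst_source : pathConst f ≫ pathSource f = 𝟙 A := rfl

-- The membership condition linking source, target and path constrains only degree 0, so in positive
-- degree the target may be prescribed with zero source and path.
open pathSubalgebra in
theorem fibrations_pathEval : fibrations K (pathEval f) := by
  intro n hn b hb
  let x : pathSubalgebra f := ofComponents f 0 (B.sign b) 0 (map_zero _) (by
    rw [proj_sign, proj_of_mem_ne hb hn.ne', smul_zero, map_zero, map_zero, map_zero, map_zero,
      sub_zero])
  refine ⟨x, ⟨x, ext ?_ ?_ ?_⟩, sign_sign b⟩
  · exact map_zero _
  · exact (proj_sign n b).trans (by rw [proj_of_mem hb]; exact (sign_of_mem hb).symm)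
  · exact map_zero (B.proj (n + 1))

-- For a cycle the path component of the equation `d x = 0` says that `path x` bounds the difference
-- of its two ends.
open pathSubalgebra in
theorem pathEval_sub_source {n : ℕ} {x : pathAlgebra f} (hx : x ∈ (pathAlgebra f).cycles n) :
    (pathEval f).toAlgHom x - f.toAlgHom ((pathSource f).toAlgHom x) ∈ B.boundaries n := by
  have h₁ : pathSubalgebra.proj f n x = x :=
    ((pathStructure f).proj_toChainAlgebra n x).symm.trans (proj_of_mem hx.1)
  have h₂ : pathSubalgebra.d f x = 0 := hx.2
  refine ⟨path (f := f) x, ?_, ?_⟩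
  · rw [← h₁]
    exact proj_mem _ _ _
  · have h := congrArg path h₂
    erw [path_d, path_zero, sub_eq_zero] at h
    exact h.symm

end PathAlgebra

/-- Lifting the identity of `B` along `pathEval f` relative to `pathConst f` gives a homotopy from
the identity to `f ∘ r`, where `r` is a strict retraction of `f`. The retraction gives injectivity
in homology, the homotopy surjectivity. -/
theorem weakEquivalences_of_llp_fibrations {A B : ChainAlgebra K} (f : A ⟶ B)
    (hf : (fibrations K).llp f) : weakEquivalences K f := by
  have := hf _ (fibrations_pathEval f)
  have sq : CommSq (pathConst f) f (pathEval f) (𝟙 B) :=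
    ⟨(pathConst_eval f).trans (Category.comp_id f).symm⟩
  let r : B ⟶ A := sq.lift ≫ pathSource f
  have hr (a : A) : r.toAlgHom (f.toAlgHom a) = a :=
    hom_congr (show f ≫ r = 𝟙 A by
      rw [← pathConst_source f, ← sq.fac_left, Category.assoc]) a
  have hs (b : B) (n : ℕ) (hb : b ∈ B.cycles n) :
      b - f.toAlgHom (r.toAlgHom b) ∈ B.boundaries n := by
    have h := pathEval_sub_source f (cyclesMap sq.lift n ⟨b, hb⟩).2
    have h' := hom_congr sq.fac_right b
    rw [comp_apply, id_apply] at h'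
    erw [h'] at h
    exact h
  intro n
  refine (bijective_homologyMap_iff f n).2 ⟨?_, fun b hb => ?_⟩
  · rintro a ha ⟨y, hy, hya⟩
    exact ⟨r.toAlgHom y, r.map_deg _ _ hy, by rw [← r.map_d, hya, hr]⟩
  · exact ⟨r.toAlgHom b, (cyclesMap r n ⟨b, hb⟩).2, hs b n hb⟩

end ChainAlgebra

/-! ## The model structure -/

namespace ChainAlgebra

variable (K : Type u) [CommRing K]

theorem preservesColimit_generatingCofibrations {J : Type u} [LinearOrder J] [Nonempty J]
    (F : J ⥤ ChainAlgebra K) {A B : ChainAlgebra K} (i : A ⟶ B)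
    (hi : generatingCofibrations K i) : PreservesColimit F (coyoneda.obj (Opposite.op A)) := by
  obtain ⟨_ | n⟩ := hi
  · exact preservesColimit_initial F initialIsInitial
  · exact preservesColimit_free F n True

theorem preservesColimit_generatingTrivialCofibrations {J : Type u} [LinearOrder J] [Nonempty J]
    (F : J ⥤ ChainAlgebra K) {A B : ChainAlgebra K} (i : A ⟶ B)
    (hi : generatingTrivialCofibrations K i) :
    PreservesColimit F (coyoneda.obj (Opposite.op A)) := by
  obtain ⟨n⟩ := hi
  exact preservesColimit_initial F initialIsInitial

theorem hasSmallObjectArgument (I : MorphismProperty (ChainAlgebra K))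
    [MorphismProperty.IsSmall.{u} I]
    (hI : ∀ {J : Type u} [LinearOrder J] [Nonempty J] (F : J ⥤ ChainAlgebra K)
      {A B : ChainAlgebra K} (i : A ⟶ B), I i →
        PreservesColimit F (coyoneda.obj (Opposite.op A))) :
    MorphismProperty.HasSmallObjectArgument.{u} I := by
  have hκ : Cardinal.IsRegular Cardinal.aleph0.{u} := Cardinal.isRegular_aleph0
  have : Fact Cardinal.aleph0.{u}.IsRegular := ⟨hκ⟩
  have := Cardinal.noMaxOrder hκ.aleph0_le
  let _ : OrderBot Cardinal.aleph0.{u}.ord.ToType :=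
    Cardinal.orderBotAleph0OrdToType
  exact ⟨⟨Cardinal.aleph0, inferInstance, inferInstance,
    { preservesColimit := fun i hi _ hf => hI hf.F i hi }⟩⟩

instance : MorphismProperty.IsSmall.{u} (generatingCofibrations K) :=
  have : Small.{u} (Option ℕ) := Countable.toSmall _
  MorphismProperty.isSmall_ofHoms _

instance : MorphismProperty.IsSmall.{u} (generatingTrivialCofibrations K) :=
  have : Small.{u} ℕ := Countable.toSmall _
  MorphismProperty.isSmall_ofHoms _

instance : MorphismProperty.HasSmallObjectArgument.{u} (generatingCofibrations K) :=
  hasSmallObjectArgument K _ (preservesColimit_generatingCofibrations K)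

instance : MorphismProperty.HasSmallObjectArgument.{u} (generatingTrivialCofibrations K) :=
  hasSmallObjectArgument K _ (preservesColimit_generatingTrivialCofibrations K)

theorem isSmallRelativeTo {A : ChainAlgebra K} (D : MorphismProperty (ChainAlgebra K))
    (hA : ∀ {J : Type u} [LinearOrder J] [Nonempty J] (F : J ⥤ ChainAlgebra K),
      PreservesColimit F (coyoneda.obj (Opposite.op A))) : IsSmallRelativeTo.{u} A D :=
  ⟨Cardinal.aleph0, ⟨Cardinal.isRegular_aleph0⟩, fun _ _ _ _ _ _ _ F _ _ => hA F⟩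

theorem cofibrations_eq : cofibrations K = (generatingCofibrations K).rlp.llp := by
  rw [generatingCofibrations_rlp]
  rfl

theorem fibrations_llp_le :
    (fibrations K).llp ≤ weakEquivalences K ⊓ (generatingCofibrations K).rlp.llp := by
  intro A B f hf
  refine ⟨weakEquivalences_of_llp_fibrations f hf, ?_⟩
  rw [generatingCofibrations_rlp]
  exact MorphismProperty.antitone_llp inf_le_left _ hf

/-- A trivial cofibration has the left lifting property with respect to fibrations. -/
theorem trivialCofibrations_eq : cofibrations K ⊓ weakEquivalences K = (fibrations K).llp := by
  refine le_antisymm (fun A B f hf => ?_) (fun A B f hf => ?_)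
  · have : (fibrations K).llp.HasFactorization (fibrations K) := by
      rw [← generatingTrivialCofibrations_rlp]
      infer_instance
    have h := MorphismProperty.factorizationData (fibrations K).llp (fibrations K) f
    -- Two-out-of-three makes `h.p` a trivial fibration; the cofibration `f` lifts against it and is
    -- therefore a retract of `h.i`.
    have hw : weakEquivalences K h.p :=
      (weakEquivalences K).of_precomp h.i h.p (weakEquivalences_of_llp_fibrations _ h.hi)
        (by rw [h.fac]; exact hf.2)
    have := hf.1 _ ⟨h.hp, hw⟩
    exact (fibrations K).llp.of_retract (RetractArrow.ofLeftLiftingProperty h.fac) h.hi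
  · have := fibrations_llp_le K f hf
    rw [← cofibrations_eq] at this
    exact this.symm

/-- The small object argument for the two generating sets gives the two weak factorization systems;
with two-out-of-three and finite limits and colimits these suffice for `ModelCategory.mk'`. -/
theorem isClosedModelStructure :
    IsClosedModelStructure (weakEquivalences K) (cofibrations K) (fibrations K) where
  multiplicative_W := inferInstance
  multiplicative_Cof := by
    rw [cofibrations_eq]
    infer_instance
  multiplicative_Fib := by
    rw [← generatingTrivialCofibrations_rlp]
    infer_instance
  exists_modelCategory := by
    let _ : HomotopicalAlgebra.CategoryWithFibrations (ChainAlgebra K) := ⟨fibrations K⟩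
    let _ : HomotopicalAlgebra.CategoryWithCofibrations (ChainAlgebra K) := ⟨cofibrations K⟩
    let _ : HomotopicalAlgebra.CategoryWithWeakEquivalences (ChainAlgebra K) :=
      ⟨weakEquivalences K⟩
    have : (HomotopicalAlgebra.weakEquivalences
        (ChainAlgebra K)).HasTwoOutOfThreeProperty :=
      inferInstanceAs (weakEquivalences K).HasTwoOutOfThreeProperty
    have h₁ : (cofibrations K).IsWeakFactorizationSystem
        (fibrations K ⊓ weakEquivalences K) := by
      rw [cofibrations_eq, ← generatingCofibrations_rlp]
      exact ⟨by simp, rfl, inferInstance⟩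
    have h₂ : (cofibrations K ⊓ weakEquivalences K).IsWeakFactorizationSystem
        (fibrations K) := by
      rw [trivialCofibrations_eq, ← generatingTrivialCofibrations_rlp]
      exact ⟨by simp, rfl, inferInstance⟩
    have : (HomotopicalAlgebra.cofibrations (ChainAlgebra K)).IsWeakFactorizationSystem
        (HomotopicalAlgebra.trivialFibrations (ChainAlgebra K)) := h₁
    have : (HomotopicalAlgebra.trivialCofibrations (ChainAlgebra K)).IsWeakFactorizationSystem
        (HomotopicalAlgebra.fibrations (ChainAlgebra K)) := h₂
    have : HasFiniteLimits (ChainAlgebra K) := hasFiniteLimits_of_hasLimitsOfSize.{u, u} _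
    have : HasFiniteColimits (ChainAlgebra K) := hasFiniteColimits_of_hasColimitsOfSize.{u, u} _
    exact ⟨HomotopicalAlgebra.ModelCategory.mk' _, rfl, rfl, rfl⟩

theorem isCofibrantlyGeneratedModelStructure :
    IsCofibrantlyGeneratedModelStructure.{u} (weakEquivalences K) (cofibrations K)
      (fibrations K) where
  hasLimits := inferInstance
  hasColimits := inferInstance
  isClosedModelStructure := isClosedModelStructure K
  exists_generating := by
    refine ⟨generatingCofibrations K, generatingTrivialCofibrations K, inferInstance,
      inferInstance, fun A B i hi => isSmallRelativeTo K _ fun F =>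
        preservesColimit_generatingCofibrations K F i hi,
      fun A B i hi => isSmallRelativeTo K _ fun F =>
        preservesColimit_generatingTrivialCofibrations K F i hi, ?_, ?_, cofibrations_eq K,
      (generatingTrivialCofibrations_rlp K).symm⟩
    -- Classes defined by a left lifting property are stable under pushouts and transfinite
    -- compositions, so cell complexes lift against all fibrations.
    · refine le_trans ?_ (fibrations_llp_le K)
      rw [← generatingTrivialCofibrations_rlp]
      exact MorphismProperty.transfiniteCompositions_le_iff.2
        (MorphismProperty.pushouts_le_llp_rlp _)
    · rw [generatingCofibrations_rlp, generatingTrivialCofibrations_rlp, inf_comm]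

end ChainAlgebra

/-! ## Quasi-free morphisms -/

namespace GradedAlg

variable {K : Type u} [CommRing K]

/-- A graded algebra as a chain algebra with zero differential. -/
def toChainAlgebra (A : GradedAlg K) : ChainAlgebra K where
  toGradedAlg := A
  d := 0
  d_mem _ _ _ := zero_mem _
  d_zero _ _ := rfl
  d_d _ := rfl
  leibniz _ _ _ _ := by simp

section Subalgebra

variable {B : GradedAlg K} (S : Subalgebra K B) (hS : ∀ n, ∀ b ∈ S, B.proj n b ∈ S)

/-- A subalgebra stable under homogeneous components, as a graded algebra. -/
noncomputable def ofSubalgebra : GradedAlg K :=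
  -- The zero differential makes the chain algebra construction available for graded algebras.
  (ChainStructure.ofRange (A := B.toChainAlgebra) S.val Subtype.val_injective
    (fun n x => ⟨⟨_, hS n x.1 x.2⟩, rfl⟩) (fun _ => zero_mem _)).toChainAlgebra.toGradedAlg

/-- The inclusion of a graded subalgebra. -/
noncomputable def ofSubalgebraVal : ofSubalgebra S hS ⟶ B :=
  Hom.mk S.val (ChainStructure.homFrom (B := B.toChainAlgebra) _ S.val
    (ChainStructure.ofRange_p (A := B.toChainAlgebra) S.val Subtype.val_injective
      (fun n x => ⟨⟨_, hS n x.1 x.2⟩, rfl⟩) (fun _ => zero_mem _))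
    (ChainStructure.ofRange_d (A := B.toChainAlgebra) S.val Subtype.val_injective
      (fun n x => ⟨⟨_, hS n x.1 x.2⟩, rfl⟩) (fun _ => zero_mem _))).map_deg

theorem exists_comp_ofSubalgebraVal {A : GradedAlg K} (f : A ⟶ B) (hf : ∀ a, f.toAlgHom a ∈ S) :
    ∃ g : A ⟶ ofSubalgebra S hS, g ≫ ofSubalgebraVal S hS = f := by
  have hinj : Function.Injective (ofSubalgebraVal S hS).toAlgHom := Subtype.val_injective
  let g : A →ₐ[K] ofSubalgebra S hS := f.toAlgHom.codRestrict S hf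
  have hg (a) : (ofSubalgebraVal S hS).toAlgHom (g a) = f.toAlgHom a := rfl
  exact ⟨homOfProj g fun n a => hinj (by rw [map_proj, hg, hg, map_proj]), rfl⟩

end Subalgebra

section Coproduct

variable {A B X : GradedAlg K} {f : A ⟶ B} {j : X ⟶ B} (hc : IsColimit (BinaryCofan.mk f j))

include hc

/-- Both coprojections factor through `S`, so the universal property gives a section of the
inclusion of `S`, which is therefore surjective. -/
theorem eq_top_of_isColimit (S : Subalgebra K B) (hS : ∀ n, ∀ b ∈ S, B.proj n b ∈ S)
    (hf : ∀ a, f.toAlgHom a ∈ S) (hj : ∀ x, j.toAlgHom x ∈ S) (b : B) : b ∈ S := by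
  obtain ⟨f', hf'⟩ := exists_comp_ofSubalgebraVal S hS f hf
  obtain ⟨j', hj'⟩ := exists_comp_ofSubalgebraVal S hS j hj
  obtain ⟨l, hl₁, hl₂⟩ := BinaryCofan.IsColimit.desc' hc f' j'
  have h : l ≫ ofSubalgebraVal S hS = 𝟙 B := by
    refine BinaryCofan.IsColimit.hom_ext hc ?_ ?_
    · exact (congrArg (fun k : A ⟶ ofSubalgebra S hS => k ≫ ofSubalgebraVal S hS) hl₁).trans hf'
    · exact (congrArg (fun k : X ⟶ ofSubalgebra S hS => k ≫ ofSubalgebraVal S hS) hl₂).trans hj'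
  have h' : (l ≫ ofSubalgebraVal S hS).toAlgHom b = b := by
    rw [h]
    rfl
  rw [← h']
  exact (show S from l.toAlgHom b).2

end Coproduct

section Free

variable {X : GradedAlg K} {V : ℕ → Type u} [∀ n, AddCommGroup (V n)] [∀ n, Module K (V n)]
  {ι : ∀ n, V n →ₗ[K] X}
  (hbij : Function.Bijective (TensorAlgebra.lift K (DirectSum.toModule K ℕ X ι)))

include hbij

theorem free_eq_top (S : Subalgebra K X) (hS : ∀ n x, ι n x ∈ S) (x : X) : x ∈ S := by
  obtain ⟨t, rfl⟩ := hbij.2 x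
  induction t using TensorAlgebra.induction with
  | algebraMap r => rw [AlgHom.commutes]; exact S.algebraMap_mem r
  | ι v =>
    rw [TensorAlgebra.lift_ι_apply]
    induction v using DirectSum.induction_on with
    | zero => rw [map_zero]; exact zero_mem _
    | of n v => exact (DirectSum.toModule_lof K (φ := ι) n v).symm ▸ hS n v
    | add v w hv hw => rw [map_add]; exact add_mem hv hw
  | mul a b ha hb => rw [map_mul]; exact S.mul_mem ha hb
  | add a b ha hb => rw [map_add]; exact S.add_mem ha hb

/-- The tensor algebra gives an algebra homomorphism; it respects degrees because the elements whose
homogeneous components it preserves form a subalgebra containing the generators. -/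
theorem exists_free_desc (hdeg : ∀ n x, ι n x ∈ X.deg n) {E : GradedAlg K}
    (φ : ∀ n, V n →ₗ[K] E) (hφ : ∀ n x, φ n x ∈ E.deg n) :
    ∃ g : X ⟶ E, ∀ n x, g.toAlgHom (ι n x) = φ n x := by
  let e := AlgEquiv.ofBijective (TensorAlgebra.lift K (DirectSum.toModule K ℕ X ι)) hbij
  let g : X →ₐ[K] E := (TensorAlgebra.lift K (DirectSum.toModule K ℕ E φ)).comp
    (e.symm : X →ₐ[K] TensorAlgebra K (DirectSum ℕ V))
  have hg (n x) : g (ι n x) = φ n x := by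
    have h : ι n x = e (TensorAlgebra.ι K (DirectSum.lof K ℕ V n x)) := by
      change _ = TensorAlgebra.lift K (DirectSum.toModule K ℕ X ι) _
      rw [TensorAlgebra.lift_ι_apply, DirectSum.toModule_lof]
    change TensorAlgebra.lift K (DirectSum.toModule K ℕ E φ) (e.symm (ι n x)) = φ n x
    rw [h, e.symm_apply_apply, TensorAlgebra.lift_ι_apply, DirectSum.toModule_lof]
  let S : Subalgebra K X :=
    { carrier := {x | ∀ n, g (X.proj n x) = E.proj n (g x)}
      mul_mem' := fun {x y} hx hy n => by
        rw [proj_mul, map_mul g x y, proj_mul, map_sum]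
        exact Finset.sum_congr rfl fun ij _ => by rw [map_mul, hx, hy]
      add_mem' := fun {x y} hx hy n => by simp only [map_add, hx n, hy n]
      algebraMap_mem' := fun r n => by
        rw [AlgHom.commutes, Algebra.algebraMap_eq_smul_one, Algebra.algebraMap_eq_smul_one,
          map_smul, map_smul, map_smul]
        by_cases h : 0 = n
        · rw [← h, proj_zero_one, proj_zero_one, map_one]
        · rw [proj_of_mem_ne one_mem h, proj_of_mem_ne one_mem h, map_zero] }
  refine ⟨homOfProj g fun n x => free_eq_top hbij S (fun m x n => ?_) x n, hg⟩
  rw [hg]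
  by_cases h : m = n
  · subst h
    rw [proj_of_mem (hdeg m x), proj_of_mem (hφ m x), hg]
  · rw [proj_of_mem_ne (hdeg m x) h, proj_of_mem_ne (hφ m x) h, map_zero]

end Free

section CoproductFree

variable {A B X E : GradedAlg K} {f : A ⟶ B} {j : X ⟶ B} (hc : IsColimit (BinaryCofan.mk f j))
  {V : ℕ → Type u} [∀ n, AddCommGroup (V n)] [∀ n, Module K (V n)] {ι : ∀ n, V n →ₗ[K] X}
  (hbij : Function.Bijective (TensorAlgebra.lift K (DirectSum.toModule K ℕ X ι)))
  (hdeg : ∀ n x, ι n x ∈ X.deg n)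

include hc hbij

/-- A homogeneous property of the elements of degree less than `n` of the coproduct with a free
graded algebra can be checked on generators. -/
theorem coproduct_induction (n : ℕ) (p : B → Prop) (zero : p 0) (one : p 1)
    (add : ∀ x y, p x → p y → p (x + y)) (smul : ∀ (r : K) x, p x → p (r • x))
    (mul : ∀ a b x y, a < n → b < n → x ∈ B.deg a → y ∈ B.deg b → p x → p y → p (x * y))
    (left : ∀ m, m < n → ∀ a ∈ A.deg m, p (f.toAlgHom a))
    (right : ∀ m, m < n → ∀ x, ι m x ∈ X.deg m → p (j.toAlgHom (ι m x)))
    (hdeg : ∀ n x, ι n x ∈ X.deg n) {m : ℕ} (hm : m < n) {b : B} (hb : b ∈ B.deg m) : p b := by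
  -- Elements whose components in all degrees below `n` satisfy `p`. A component of a product in
  -- degree `m` involves only components of degree at most `m`, so these form a subalgebra.
  let S : Subalgebra K B :=
    { carrier := {x | ∀ m < n, p (B.proj m x)}
      mul_mem' := fun {x y} hx hy m hm => by
        rw [proj_mul]
        refine Finset.sum_induction _ p add zero fun ij hij => ?_
        rw [Finset.HasAntidiagonal.mem_antidiagonal] at hij
        exact mul _ _ _ _ (by omega) (by omega) (proj_mem _ _ _) (proj_mem _ _ _)
          (hx _ (by omega)) (hy _ (by omega))
      add_mem' := fun {x y} hx hy m hm => by
        rw [map_add]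
        exact add _ _ (hx m hm) (hy m hm)
      algebraMap_mem' := fun r m hm => by
        rw [Algebra.algebraMap_eq_smul_one, map_smul]
        by_cases h : 0 = m
        · rw [← h, proj_zero_one]
          exact smul r _ one
        · rw [proj_of_mem_ne one_mem h]
          exact smul r _ zero }
  have hS : ∀ k, ∀ b ∈ S, B.proj k b ∈ S := fun k b hb m hm => by
    by_cases h : k = m
    · subst h
      rw [proj_proj_self]
      exact hb k hm
    · rw [proj_proj_ne h]
      exact zero
  have hmem := eq_top_of_isColimit hc S hS
    (fun a m hm => by
      rw [← map_proj]
      exact left m hm _ (proj_mem _ _ _))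
    (fun x => free_eq_top hbij (S.comap j.toAlgHom) (fun k x m hm => by
      change p (B.proj m (j.toAlgHom (ι k x)))
      by_cases h : k = m
      · subst h
        rw [proj_of_mem (j.map_deg _ _ (hdeg k x))]
        exact right k hm x (hdeg k x)
      · rw [proj_of_mem_ne (j.map_deg _ _ (hdeg k x)) h]
        exact zero) x) b m hm
  rwa [proj_of_mem hb] at hmem

include hdeg

theorem exists_coproduct_desc (u : A ⟶ E) (φ : ∀ n, V n →ₗ[K] E) (hφ : ∀ n x, φ n x ∈ E.deg n) :
    ∃ g : B ⟶ E, (∀ a, g.toAlgHom (f.toAlgHom a) = u.toAlgHom a) ∧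
      ∀ n x, g.toAlgHom (j.toAlgHom (ι n x)) = φ n x := by
  obtain ⟨k, hk⟩ := exists_free_desc hbij hdeg φ hφ
  obtain ⟨g, hg₁, hg₂⟩ := BinaryCofan.IsColimit.desc' hc u k
  exact ⟨g, fun a => congrArg (fun h : A ⟶ E => h.toAlgHom a) hg₁,
    fun n x => (congrArg (fun h : X ⟶ E => h.toAlgHom (ι n x)) hg₂).trans (hk n x)⟩

theorem coproduct_hom_eq {g g' : B ⟶ E} {n : ℕ}
    (left : ∀ a, g.toAlgHom (f.toAlgHom a) = g'.toAlgHom (f.toAlgHom a))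
    (right : ∀ m < n, ∀ x, g.toAlgHom (j.toAlgHom (ι m x)) = g'.toAlgHom (j.toAlgHom (ι m x)))
    {m : ℕ} (hm : m < n) {b : B} (hb : b ∈ B.deg m) : g.toAlgHom b = g'.toAlgHom b :=
  coproduct_induction hc hbij n (fun b => g.toAlgHom b = g'.toAlgHom b) (by simp) (by simp)
    (fun x y hx hy => by simp only [map_add, hx, hy]) (fun r x hx => by simp only [map_smul, hx])
    (fun _ _ x y _ _ _ _ hx hy => by simp only [map_mul, hx, hy]) (fun m _ a _ => left a)
    (fun m hm x _ => right m hm x) hdeg hm hb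

end CoproductFree

end GradedAlg

namespace ChainAlgebra

variable {K : Type u} [CommRing K]

open GradedAlg

/-! ### Degreewise construction of lifts for quasi-free maps. -/

section Lift

variable {A B E F : ChainAlgebra K} {f : A ⟶ B} {p : E ⟶ F} {u : A ⟶ E} {v : B ⟶ F}

/-- The graded homomorphism `g` extends `u` and, on elements of degree less than `n`, it commutes
with the differentials and lifts `v`. -/
structure IsLiftBelow (f : A ⟶ B) (p : E ⟶ F) (u : A ⟶ E) (v : B ⟶ F)
    (g : B.toGradedAlg ⟶ E.toGradedAlg) (n : ℕ) : Prop where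
  left : ∀ a, g.toAlgHom (f.toAlgHom a) = u.toAlgHom a
  map_d : ∀ m < n, ∀ b ∈ B.deg m, E.d (g.toAlgHom b) = g.toAlgHom (B.d b)
  right : ∀ m < n, ∀ b ∈ B.deg m, p.toAlgHom (g.toAlgHom b) = v.toAlgHom b

variable (sq : CommSq u f p v) (hp : (generatingCofibrations K).rlp p)
  {X : GradedAlg K} {j : X ⟶ B.toGradedAlg}
  (hc : IsColimit (BinaryCofan.mk (show A.toGradedAlg ⟶ B.toGradedAlg from f.toHom) j))
  {V : ℕ → Type u} [∀ n, AddCommGroup (V n)] [∀ n, Module K (V n)] {ι : ∀ n, V n →ₗ[K] X}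
  (hbij : Function.Bijective (TensorAlgebra.lift K (DirectSum.toModule K ℕ X ι)))
  (hdeg : ∀ n x, ι n x ∈ X.deg n)

-- The pairs (solution, generator) form a submodule `Q` of `E × V n`. Lifting against the generating
-- cofibrations makes `Q` surject onto `V n`, and projectivity splits this surjection, turning
-- pointwise solutions into a linear choice.
include hp hdeg in
theorem exists_lift_generators {n : ℕ} [Module.Projective K (V n)]
    {g : B.toGradedAlg ⟶ E.toGradedAlg} (hg : IsLiftBelow f p u v g n) :
    ∃ φ : V n →ₗ[K] E, ∀ x, φ x ∈ E.deg n ∧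
      E.d (φ x) = g.toAlgHom (B.d (j.toAlgHom (ι n x))) ∧
      p.toAlgHom (φ x) = v.toAlgHom (j.toAlgHom (ι n x)) := by
  rw [generatingCofibrations_rlp_iff] at hp
  let Q : Submodule K (E × V n) :=
    { carrier := {y | y.1 ∈ E.deg n ∧
        E.d y.1 = g.toAlgHom (B.d (j.toAlgHom (ι n y.2))) ∧
        p.toAlgHom y.1 = v.toAlgHom (j.toAlgHom (ι n y.2))}
      add_mem' := fun {x y} hx hy => ⟨add_mem hx.1 hy.1,
        by simp only [Prod.fst_add, Prod.snd_add, map_add, hx.2.1, hy.2.1],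
        by simp only [Prod.fst_add, Prod.snd_add, map_add, hx.2.2, hy.2.2]⟩
      zero_mem' := ⟨zero_mem _, by simp, by simp⟩
      smul_mem' := fun r x hx => ⟨Submodule.smul_mem _ r hx.1,
        by simp only [Prod.smul_fst, Prod.smul_snd, map_smul, hx.2.1],
        by simp only [Prod.smul_fst, Prod.smul_snd, map_smul, hx.2.2]⟩ }
  have hsurj : Function.Surjective ((LinearMap.snd K E (V n)).comp Q.subtype) := by
    intro x
    have hx : j.toAlgHom (ι n x) ∈ B.deg n := j.map_deg _ _ (hdeg n x)
    suffices h : ∃ e ∈ E.deg n, E.d e = g.toAlgHom (B.d (j.toAlgHom (ι n x))) ∧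
        p.toAlgHom e = v.toAlgHom (j.toAlgHom (ι n x)) by
      obtain ⟨e, he⟩ := h
      exact ⟨⟨(e, x), he⟩, rfl⟩
    obtain _ | n := n
    · obtain ⟨e, he, hpe⟩ := hp.1 _ (v.map_deg _ _ hx)
      exact ⟨e, he, by rw [E.d_zero e he, B.d_zero _ hx, map_zero], hpe⟩
    · have hdx := B.d_mem n _ hx
      -- The differential of a generator has degree `n`, where `g` is already a chain map over `v`;
      -- hence its image is a cycle and the square commutes.
      refine hp.2 n _ ⟨g.map_deg _ _ hdx, ?_⟩ _ (v.map_deg _ _ hx) ?_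
      · exact (hg.map_d n n.lt_succ_self _ hdx).trans (by rw [B.d_d, map_zero])
      · rw [hg.right n n.lt_succ_self _ hdx, v.map_d]
  obtain ⟨s, hs⟩ := Module.projective_lifting_property _ LinearMap.id hsurj
  have hs' (x) : (s x).1.2 = x := LinearMap.congr_fun hs x
  refine ⟨(LinearMap.fst K E (V n)).comp (Q.subtype.comp s), fun x => ?_⟩
  have h := (s x).2
  refine ⟨h.1, h.2.1.trans ?_, h.2.2.trans ?_⟩ <;> rw [hs']

include sq hp hc hbij hdeg

/-- Redefine `g` on the generators of degree `n` alone. Being a chain map over `v` is compatible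
with products, hence need be checked only on `A` and on the generators of degree at most `n`. -/
theorem exists_isLiftBelow_succ {n : ℕ} [Module.Projective K (V n)]
    {g : B.toGradedAlg ⟶ E.toGradedAlg} (hg : IsLiftBelow f p u v g n) :
    ∃ g' : B.toGradedAlg ⟶ E.toGradedAlg, IsLiftBelow f p u v g' (n + 1) ∧
      ∀ m < n, ∀ b ∈ B.deg m, g'.toAlgHom b = g.toAlgHom b := by
  obtain ⟨φ, hφ⟩ := exists_lift_generators hp hdeg hg
  let ψ : ∀ m, V m →ₗ[K] E := Function.update
    (fun m => g.toAlgHom.toLinearMap.comp (j.toAlgHom.toLinearMap.comp (ι m))) n φ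
  have hψn : ψ n = φ := Function.update_self _ _ _
  have hψ (m : ℕ) (hm : m ≠ n) (x : V m) : ψ m x = g.toAlgHom (j.toAlgHom (ι m x)) := by
    have h : ψ m = _ := Function.update_of_ne hm _ _
    rw [h]
    rfl
  obtain ⟨g', hf, hj⟩ := exists_coproduct_desc (E := E.toGradedAlg) hc hbij hdeg u.toHom ψ
    (fun m x => by
      by_cases h : m = n
      · subst h
        rw [hψn]
        exact (hφ x).1
      · rw [hψ m h]
        exact g.map_deg _ _ (j.map_deg _ _ (hdeg m x)))
  have hagree (m : ℕ) (hm : m < n) (b : B) (hb : b ∈ B.deg m) :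
      g'.toAlgHom b = g.toAlgHom b :=
    coproduct_hom_eq hc hbij hdeg (fun a => (hf a).trans (hg.left a).symm)
      (fun m hm x => (hj m x).trans (hψ m hm.ne x)) hm hb
  -- The differential lowers the degree below `n`, where the new values on `V n` play no role, so
  -- the equations solved with `g` hold for `g'`.
  have hagree_d (m : ℕ) (hm : m ≤ n) (b : B) (hb : b ∈ B.deg m) :
      g'.toAlgHom (B.d b) = g.toAlgHom (B.d b) := by
    obtain _ | m := m
    · rw [B.d_zero b hb, map_zero, map_zero]
    · exact hagree m hm _ (B.d_mem _ _ hb)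
  have key {m : ℕ} (hm : m < n + 1) {b : B} (hb : b ∈ B.deg m) :
      E.d (g'.toAlgHom b) = g'.toAlgHom (B.d b) ∧
        p.toAlgHom (g'.toAlgHom b) = v.toAlgHom b := by
    refine coproduct_induction hc hbij (n + 1) (fun b => E.d (g'.toAlgHom b) =
      g'.toAlgHom (B.d b) ∧ p.toAlgHom (g'.toAlgHom b) = v.toAlgHom b) (by simp) ?_ ?_ ?_ ?_ ?_
      ?_ hdeg hm hb
    · simp [d_one]
    · rintro x y ⟨hx, hx'⟩ ⟨hy, hy'⟩
      simp only [map_add, hx, hx', hy, hy', and_self]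
    · rintro r x ⟨hx, hx'⟩
      simp only [map_smul, hx, hx', and_self]
    · rintro a b x y - - hxa hyb ⟨hx, hx'⟩ ⟨hy, hy'⟩
      refine ⟨?_, by simp only [map_mul, hx', hy']⟩
      rw [map_mul, E.leibniz a _ _ (g'.map_deg _ _ hxa), B.leibniz a _ _ hxa, hx, hy]
      simp only [map_add, map_mul, map_pow, map_neg, map_one]
    · intro m _ a _
      have h₁ : g'.toAlgHom (f.toAlgHom a) = u.toAlgHom a := hf a
      have h₂ : g'.toAlgHom (f.toAlgHom (A.d a)) = u.toAlgHom (A.d a) := hf (A.d a)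
      constructor
      · change E.d (g'.toAlgHom (f.toAlgHom a)) = g'.toAlgHom (B.d (f.toAlgHom a))
        rw [← f.map_d, h₁, h₂, u.map_d]
      · change p.toAlgHom (g'.toAlgHom (f.toAlgHom a)) = v.toAlgHom (f.toAlgHom a)
        rw [h₁]
        exact hom_congr sq.w a
    · intro m hm x hx
      rw [hagree_d m (by omega) _ (j.map_deg _ _ hx), hj]
      by_cases h : m = n
      · subst h
        rw [hψn]
        exact (hφ x).2
      · rw [hψ m h]
        exact ⟨hg.map_d m (by omega) _ (j.map_deg _ _ hx),
          hg.right m (by omega) _ (j.map_deg _ _ hx)⟩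
  exact ⟨g', ⟨hf, fun m hm b hb => (key hm hb).1, fun m hm b hb => (key hm hb).2⟩, hagree⟩

/-- The successive partial lifts stabilise in each degree; their limit is again a graded
homomorphism by the universal property, and it is a chain map over `v` because both conditions are
checked degree by degree. -/
theorem hasLift_of_free [∀ n, Module.Projective K (V n)] : sq.HasLift := by
  obtain ⟨g₀, hg₀, -⟩ := exists_coproduct_desc (E := E.toGradedAlg) hc hbij hdeg u.toHom
    (fun _ => 0) (fun _ _ => zero_mem _)
  have step (n : ℕ) (g : {g // IsLiftBelow f p u v g n}) :
      ∃ g' : {g // IsLiftBelow f p u v g (n + 1)},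
        ∀ m < n, ∀ b ∈ B.deg m, g'.1.toAlgHom b = g.1.toAlgHom b := by
    obtain ⟨g', hg', h⟩ := exists_isLiftBelow_succ sq hp hc hbij hdeg g.2
    exact ⟨⟨g', hg'⟩, h⟩
  choose s hs using step
  let G (n : ℕ) : {g // IsLiftBelow f p u v g n} :=
    Nat.rec ⟨g₀, hg₀, fun m hm => absurd hm m.not_lt_zero, fun m hm => absurd hm m.not_lt_zero⟩
      s n
  have hG {n k : ℕ} (h : n ≤ k) (m : ℕ) (hm : m < n) (b : B) (hb : b ∈ B.deg m) :
      (G k).1.toAlgHom b = (G n).1.toAlgHom b := by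
    induction k, h using Nat.le_induction with
    | base => rfl
    | succ k hk ih => exact (hs k (G k) m (by omega) b hb).trans ih
  -- `G (n + 1)` is the first stage guaranteed to be correct in degree `n`, and later stages agree
  -- with it there.
  obtain ⟨g, hf, hj⟩ := exists_coproduct_desc (E := E.toGradedAlg) hc hbij hdeg u.toHom
    (fun n => (G (n + 1)).1.toAlgHom.toLinearMap.comp (j.toAlgHom.toLinearMap.comp (ι n)))
    (fun n x => (G (n + 1)).1.map_deg _ _ (j.map_deg _ _ (hdeg n x)))
  have hg {n m : ℕ} (hm : m < n) {b : B} (hb : b ∈ B.deg m) :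
      g.toAlgHom b = (G n).1.toAlgHom b :=
    coproduct_hom_eq hc hbij hdeg (fun a => (hf a).trans ((G n).2.left a).symm)
      (fun m hm x => (hj m x).trans (hG hm m m.lt_succ_self _ (j.map_deg _ _ (hdeg m x))).symm)
      hm hb
  have hd (b : B) : g.toAlgHom (B.d b) = E.d (g.toAlgHom b) := by
    refine homogeneous_induction b (by simp) (fun n b hb => ?_)
      fun x y hx hy => by simp only [map_add, hx, hy]
    rw [hg n.lt_succ_self hb, (G (n + 1)).2.map_d n n.lt_succ_self b hb]
    obtain _ | n := n
    · rw [B.d_zero b hb, map_zero, map_zero]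
    · exact hg (n := n + 1 + 1) (m := n) (Nat.lt_add_of_pos_right Nat.two_pos) (B.d_mem _ _ hb)
  have hv (b : B) : p.toAlgHom (g.toAlgHom b) = v.toAlgHom b := by
    refine homogeneous_induction b (by simp) (fun n b hb => ?_)
      fun x y hx hy => by simp only [map_add, hx, hy]
    rw [hg n.lt_succ_self hb, (G (n + 1)).2.right n n.lt_succ_self b hb]
  exact ⟨⟨⟨{ g with map_d := hd }, hom_ext hf, hom_ext hv⟩⟩⟩

end Lift

theorem quasiFree_le_cofibrations : quasiFree K ≤ cofibrations K := by
  rintro A B f ⟨X, j, ⟨V, _, _, ι, hfree, hdeg, hbij⟩, ⟨hc⟩⟩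
  rw [cofibrations_eq]
  intro E F p hp
  -- Each `V n` is a direct summand of the free module `⨁ n, V n`; it need not itself be free, but
  -- it is projective.
  have (n : ℕ) : Module.Projective K (V n) :=
    Module.Projective.of_split (DirectSum.lof K ℕ V n) (DirectSum.component K ℕ V n)
      (LinearMap.ext fun x => DirectSum.component.lof_self K n x)
  exact ⟨fun sq => hasLift_of_free sq hp hc hbij hdeg⟩

end ChainAlgebra

theorem mainTheorem5 (K : Type u) [CommRing K] :
    IsCofibrantlyGeneratedModelStructure.{u}
      (ChainAlgebra.weakEquivalences K) (ChainAlgebra.cofibrations K)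
      (ChainAlgebra.fibrations K) ∧
    ChainAlgebra.quasiFree K ≤ ChainAlgebra.cofibrations K :=
  ⟨ChainAlgebra.isCofibrantlyGeneratedModelStructure K, ChainAlgebra.quasiFree_le_cofibrations⟩
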